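/- Let $s$ be the Fréchet space of complex sequences $\xi=(\xi_j)_{j\ge 1}$ with $|\xi|_q:=\big(\sum_{j}|\xi_j|^2j^{2q}\big)^{1/2}<\infty$ for all $q\in\mathbb N_0$, topologized by the norms $|\cdot|_q$. Let $s'$ be the space of complex sequences with $|\xi|'_q:=\big(\sum_{j}|\xi_j|^2j^{-2q}\big)^{1/2}<\infty$ for some $q\in\mathbb N_0$, with the locally convex inductive limit topology of the normed spaces $(\{\xi:|\xi|'_q<\infty\},|\cdot|'_q)$. Let $L(s',s)$ be the space of continuous linear operators from $s'$ to $s$, with the fundamental system of norms $\|x\|_q:=\sup_{|\xi|'_q\le 1}|x\xi|_q$, $q\in\mathbb N_0$. Through $\ell_2\hookrightarrow s'\to s\hookrightarrow\ell_2$ every element of $L(s',s)$ is regarded as a bounded operator on the Hilbert space $\ell_2$; normality, infinite- or finite-dimensionality (of the range), products and projections (always orthogonal) are understood for these operators on $\ell_2$. A spectral representation of $x\in L(s',s)$ is a pair of sequences $(\lambda_n)_{n\in\mathbb N}$, $(P_n)_{n\in\mathbb N}$ such that - $(\lambda_n)_n\in s$, the $\lambda_n$ are nonzero and pairwise distinct,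 and $|\lambda_1|\ge|\lambda_2|\ge\cdots$; - the $P_n$ are nonzero finite-dimensional projections belonging to $L(s',s)$, with $P_mP_n=0$ for $m\ne n$; - $x=\sum_{n=1}^\infty\lambda_nP_n$ with absolute convergence in $L(s',s)$: for every $q\in\mathbb N_0$, $\sum_n\|\lambda_nP_n\|_q<\infty$ and $\big\|x-\sum_{n\le N}\lambda_nP_n\big\|_q\to0$ as $N\to\infty$. **Theorem.** Every infinite-dimensional normal operator $x$ in $L(s',s)$ has a spectral representation. It is unique up to the order of terms whose coefficients have equal modulus: if $(\lambda_n,P_n)_n$ and $(\lambda'_n,P'_n)_n$ are spectral representations of $x$, then there is a permutation $\sigma$ of $\mathbb N$ with $\lambda'_n=\lambda_{\sigma(n)}$, $P'_n=P_{\sigma(n)}$ and $|\lambda_{\sigma(n)}|=|\lambda_n|$ for all $n$. Moreover, for every spectral representation of $x$, $(|\lambda_n|^\theta\|P_n\|_q)_{n\in\mathbb N}\in s$ for all $q\in\mathbb N_0$ and all $\theta\in(0,1]$. -/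

import Mathlib

open Filter Topology

noncomputable section

namespace SmoothOp

/-! ### Weighted `ℓ²` norms

Sequences are indexed by `j : ℕ` starting from `0`, so the weight of the term `ξ j` is
`((j : ℝ) + 1) ^ (2 * k)`. The integer exponent `k = q` gives the norms of the rapidly decreasing
sequences, `k = -q` those of the slowly increasing sequences. -/

/-- The weighted `ℓ²` sum of exponent `k` of the sequence `ξ` is finite. -/
def HasFiniteNorm (k : ℤ) (ξ : ℕ → ℂ) : Prop :=
  Summable fun j : ℕ => ‖ξ j‖ ^ 2 * ((j : ℝ) + 1) ^ (2 * k)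

/-- The norm `(∑ j, |ξ j|² (j+1)^(2k))^(1/2)`, meaningful when `HasFiniteNorm k ξ`. -/
def wnorm (k : ℤ) (ξ : ℕ → ℂ) : ℝ :=
  √(∑' j : ℕ, ‖ξ j‖ ^ 2 * ((j : ℝ) + 1) ^ (2 * k))

/-- The weighted sequence `(j+1)^k ξ j`. -/
def weighted (k : ℤ) (ξ : ℕ → ℂ) (j : ℕ) : ℂ := (((j : ℝ) + 1) ^ k : ℝ) * ξ j

theorem norm_weighted_sq (k : ℤ) (ξ : ℕ → ℂ) (j : ℕ) :
    ‖weighted k ξ j‖ ^ 2 = ‖ξ j‖ ^ 2 * ((j : ℝ) + 1) ^ (2 * k) := by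
  have h : (0 : ℝ) < (j : ℝ) + 1 := by positivity
  rw [weighted, norm_mul, mul_pow, Complex.norm_real, Real.norm_eq_abs, sq_abs, mul_comm 2 k,
    zpow_mul, mul_comm]
  norm_cast

theorem hasFiniteNorm_iff (k : ℤ) (ξ : ℕ → ℂ) :
    HasFiniteNorm k ξ ↔ Memℓp (weighted k ξ) 2 := by
  rw [memℓp_gen_iff (by norm_num), HasFiniteNorm]
  simp only [← norm_weighted_sq]
  norm_num

theorem wnorm_eq (k : ℤ) (ξ : ℕ → ℂ) (h : Memℓp (weighted k ξ) 2) :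
    wnorm k ξ = ‖(⟨weighted k ξ, h⟩ : lp (fun _ : ℕ => ℂ) 2)‖ := by
  rw [lp.norm_eq_tsum_rpow (by norm_num), wnorm, Real.sqrt_eq_rpow]
  simp only [← norm_weighted_sq]
  norm_num

theorem weighted_add (k : ℤ) (ξ η : ℕ → ℂ) :
    weighted k (ξ + η) = weighted k ξ + weighted k η := by
  ext j; simp [weighted, mul_add]

theorem weighted_smul (k : ℤ) (c : ℂ) (ξ : ℕ → ℂ) :
    weighted k (c • ξ) = c • weighted k ξ := by
  ext j; simp [weighted, mul_left_comm]

theorem HasFiniteNorm.add {k : ℤ} {ξ η : ℕ → ℂ} (hξ : HasFiniteNorm k ξ)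
    (hη : HasFiniteNorm k η) : HasFiniteNorm k (ξ + η) := by
  rw [hasFiniteNorm_iff] at *
  rw [weighted_add]; exact hξ.add hη

theorem HasFiniteNorm.smul {k : ℤ} {ξ : ℕ → ℂ} (c : ℂ) (hξ : HasFiniteNorm k ξ) :
    HasFiniteNorm k (c • ξ) := by
  rw [hasFiniteNorm_iff] at *
  rw [weighted_smul]; exact hξ.const_smul c

theorem hasFiniteNorm_zero (k : ℤ) : HasFiniteNorm k 0 := by
  simp [HasFiniteNorm, summable_zero]

theorem HasFiniteNorm.mono {k l : ℤ} (hkl : l ≤ k) {ξ : ℕ → ℂ} (h : HasFiniteNorm k ξ) :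
    HasFiniteNorm l ξ := by
  refine Summable.of_nonneg_of_le (fun j => by positivity) (fun j => ?_) h
  have h1 : (1 : ℝ) ≤ (j : ℝ) + 1 := by linarith [Nat.cast_nonneg (α := ℝ) j]
  exact mul_le_mul_of_nonneg_left (zpow_le_zpow_right₀ h1 (by omega)) (by positivity)

theorem wnorm_add_le {k : ℤ} {ξ η : ℕ → ℂ} (hξ : HasFiniteNorm k ξ) (hη : HasFiniteNorm k η) :
    wnorm k (ξ + η) ≤ wnorm k ξ + wnorm k η := by
  have h1 := (hasFiniteNorm_iff k ξ).1 hξ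
  have h2 := (hasFiniteNorm_iff k η).1 hη
  have h3 := (hasFiniteNorm_iff k _).1 (hξ.add hη)
  rw [wnorm_eq k ξ h1, wnorm_eq k η h2, wnorm_eq k _ h3]
  refine le_trans (le_of_eq ?_) (norm_add_le _ _)
  congr 1
  exact Subtype.ext (weighted_add k ξ η)

theorem wnorm_smul {k : ℤ} (c : ℂ) {ξ : ℕ → ℂ} (hξ : HasFiniteNorm k ξ) :
    wnorm k (c • ξ) = ‖c‖ * wnorm k ξ := by
  have h1 := (hasFiniteNorm_iff k ξ).1 hξ
  have h3 := (hasFiniteNorm_iff k _).1 (hξ.smul c)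
  rw [wnorm_eq k ξ h1, wnorm_eq k _ h3, ← norm_smul]
  congr 1
  exact Subtype.ext (weighted_smul k c ξ)

/-! ### The Fréchet space `s` of rapidly decreasing sequences -/

/-- The linear space of rapidly decreasing sequences, as a subspace of `ℂ^ℕ`. -/
def rapidSubmodule : Submodule ℂ (ℕ → ℂ) where
  carrier := {ξ | ∀ q : ℕ, HasFiniteNorm (q : ℤ) ξ}
  add_mem' h1 h2 q := (h1 q).add (h2 q)
  zero_mem' _ := hasFiniteNorm_zero _
  smul_mem' c _ h q := (h q).smul c

/-- The space `s`, a type of its own so that it does not inherit the topology of `ℂ^ℕ`. -/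
def S : Type := rapidSubmodule

instance : AddCommGroup S := inferInstanceAs (AddCommGroup rapidSubmodule)
instance : Module ℂ S := inferInstanceAs (Module ℂ rapidSubmodule)

/-- The sequence underlying an element of `s`. -/
def S.toFun : S →ₗ[ℂ] (ℕ → ℂ) := rapidSubmodule.subtype

theorem S.hasFiniteNorm (ξ : S) (q : ℕ) : HasFiniteNorm (q : ℤ) ξ.toFun := ξ.2 q

/-- The norm `|·|_q` on `s`. -/
def S.seminorm : SeminormFamily ℂ S ℕ := fun q =>
  Seminorm.of (fun ξ => wnorm (q : ℤ) ξ.toFun)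
    (fun ξ η => by
      rw [map_add]; exact wnorm_add_le (ξ.hasFiniteNorm q) (η.hasFiniteNorm q))
    (fun c ξ => by rw [map_smul]; exact wnorm_smul c (ξ.hasFiniteNorm q))

/-- The topology of `s` given by the norms `|·|_q`. -/
instance : TopologicalSpace S := S.seminorm.moduleFilterBasis.topology

theorem S.withSeminorms : WithSeminorms S.seminorm := ⟨rfl⟩

instance : IsTopologicalAddGroup S := S.withSeminorms.topologicalAddGroup
instance : ContinuousSMul ℂ S := S.withSeminorms.continuousSMul

/-! ### The space `s'` of slowly increasing sequences -/

/-- The linear space of slowly increasing sequences, as a subspace of `ℂ^ℕ`. -/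
def slowSubmodule : Submodule ℂ (ℕ → ℂ) where
  carrier := {ξ | ∃ q : ℕ, HasFiniteNorm (-(q : ℤ)) ξ}
  add_mem' := by
    rintro a b ⟨q, hq⟩ ⟨r, hr⟩
    exact ⟨max q r, (hq.mono (by simp)).add (hr.mono (by simp))⟩
  zero_mem' := ⟨0, hasFiniteNorm_zero _⟩
  smul_mem' := by
    rintro c a ⟨q, hq⟩
    exact ⟨q, hq.smul c⟩

/-- The space `s'`, a type of its own so that it does not inherit the topology of `ℂ^ℕ`. -/
def S' : Type := slowSubmodule

instance : AddCommGroup S' := inferInstanceAs (AddCommGroup slowSubmodule)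
instance : Module ℂ S' := inferInstanceAs (Module ℂ slowSubmodule)

/-- The sequence underlying an element of `s'`. -/
def S'.toFun : S' →ₗ[ℂ] (ℕ → ℂ) := slowSubmodule.subtype

/-- The seminorms on `s'` whose restriction to each step `{ξ : |ξ|'_q < ∞}`, normed by `|·|'_q`,
is continuous. -/
def S'.LimitSeminorm : Type :=
  {p : Seminorm ℂ S' // ∀ q : ℕ, ∃ C : ℝ, ∀ ξ : S', HasFiniteNorm (-(q : ℤ)) ξ.toFun →
    p ξ ≤ C * wnorm (-(q : ℤ)) ξ.toFun}

instance : Nonempty S'.LimitSeminorm := ⟨⟨0, fun _ => ⟨0, fun _ _ => by simp⟩⟩⟩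

/-- The family of all seminorms that are continuous on every step. -/
def S'.seminorm : SeminormFamily ℂ S' S'.LimitSeminorm := fun p => p.1

/-- The (locally convex) inductive limit topology of `s'`: the finest locally convex topology for
which the inclusions of all steps `({ξ : |ξ|'_q < ∞}, |·|'_q)` are continuous. -/
instance : TopologicalSpace S' := S'.seminorm.moduleFilterBasis.topology

theorem S'.withSeminorms : WithSeminorms S'.seminorm := ⟨rfl⟩

instance : IsTopologicalAddGroup S' := S'.withSeminorms.topologicalAddGroup
instance : ContinuousSMul ℂ S' := S'.withSeminorms.continuousSMul

/-! ### The space `L(s', s)` -/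

/-- The continuous linear operators from `s'` to `s`. -/
abbrev L : Type := S' →L[ℂ] S

/-- The set of values `|xξ|_q` for `ξ` in the closed unit ball of `|·|'_q`. -/
def unitBallValues (q : ℕ) (x : L) : Set ℝ :=
  {t | ∃ ξ : S', HasFiniteNorm (-(q : ℤ)) ξ.toFun ∧ wnorm (-(q : ℤ)) ξ.toFun ≤ 1 ∧
    t = wnorm (q : ℤ) (x ξ).toFun}

/-- The norm `‖x‖_q = sup {|xξ|_q : |ξ|'_q ≤ 1}` on `L(s', s)`. -/
def opNorm (q : ℕ) (x : L) : ℝ := sSup (unitBallValues q x)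

/-- Every continuous seminorm on `s'` is continuous on the steps. -/
theorem S'.bound_of_continuous (p : Seminorm ℂ S') (hp : Continuous p) (q : ℕ) :
    ∃ C : ℝ, 0 ≤ C ∧ ∀ ξ : S', HasFiniteNorm (-(q : ℤ)) ξ.toFun →
      p ξ ≤ C * wnorm (-(q : ℤ)) ξ.toFun := by
  obtain ⟨F, C, -, hC⟩ := Seminorm.bound_of_continuous S'.withSeminorms p hp
  choose D hD using fun i : S'.LimitSeminorm => i.2 q
  refine ⟨C * ∑ i ∈ F, |D i|, by positivity, fun ξ hξ => (hC ξ).trans ?_⟩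
  have hw : 0 ≤ wnorm (-(q : ℤ)) ξ.toFun := Real.sqrt_nonneg _
  rw [smul_apply, NNReal.smul_def, smul_eq_mul, mul_assoc]
  refine mul_le_mul_of_nonneg_left ?_ C.2
  refine (Seminorm.finset_sup_le_sum S'.seminorm F ξ).trans ?_
  have hs : ∀ F : Finset S'.LimitSeminorm,
      (∑ i ∈ F, S'.seminorm i) ξ = ∑ i ∈ F, S'.seminorm i ξ := by
    intro F
    classical
    induction F using Finset.induction_on with
    | empty => simp
    | insert a F ha ih => rw [Finset.sum_insert ha, Finset.sum_insert ha, add_apply]; simp [ih]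
  rw [hs, Finset.sum_mul]
  exact Finset.sum_le_sum fun i _ =>
    (hD i ξ hξ).trans (mul_le_mul_of_nonneg_right (le_abs_self _) hw)

/-- The supremum defining `opNorm` is always a genuine one. -/
theorem isLUB_opNorm (q : ℕ) (x : L) : IsLUB (unitBallValues q x) (opNorm q x) := by
  refine isLUB_csSup ⟨_, 0, ?_, ?_, rfl⟩ ?_
  · rw [map_zero]; exact hasFiniteNorm_zero _
  · rw [map_zero]; simp [wnorm]
  · obtain ⟨C, hC0, hC⟩ := S'.bound_of_continuous ((S.seminorm q).comp x.toLinearMap)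
      ((S.withSeminorms.continuous_seminorm q).comp x.continuous) q
    refine ⟨C, ?_⟩
    rintro t ⟨ξ, h1, h2, rfl⟩
    exact (hC ξ h1).trans (by nlinarith)

/-! ### The embedding of `L(s', s)` into the bounded operators on `ℓ²` -/

/-- The Hilbert space `ℓ²`. -/
abbrev L2 : Type := lp (fun _ : ℕ => ℂ) 2

theorem weighted_zero_exp (ξ : ℕ → ℂ) : weighted 0 ξ = ξ := by
  ext j; simp [weighted]

theorem L2.hasFiniteNorm (ξ : L2) : HasFiniteNorm 0 (ξ : ℕ → ℂ) := by
  rw [hasFiniteNorm_iff, weighted_zero_exp]; exact ξ.2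

theorem L2.norm_eq (ξ : L2) : wnorm 0 (ξ : ℕ → ℂ) = ‖ξ‖ := by
  rw [wnorm_eq 0 _ ((hasFiniteNorm_iff 0 _).1 (L2.hasFiniteNorm ξ))]
  congr 1
  exact Subtype.ext (weighted_zero_exp _)

theorem S.memℓp (ξ : S) : Memℓp ξ.toFun 2 := by
  have h := (hasFiniteNorm_iff 0 _).1 (ξ.hasFiniteNorm 0)
  rwa [weighted_zero_exp] at h

/-- The inclusion of `ℓ²` into `s'`. -/
def inclL2 : L2 →L[ℂ] S' where
  toFun ξ := ⟨(ξ : ℕ → ℂ), 0, by simpa using L2.hasFiniteNorm ξ⟩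
  map_add' _ _ := rfl
  map_smul' _ _ := rfl
  cont := by
    let f : L2 →ₗ[ℂ] S' :=
      { toFun := fun ξ => ⟨(ξ : ℕ → ℂ), 0, by simpa using L2.hasFiniteNorm ξ⟩
        map_add' := fun _ _ => rfl
        map_smul' := fun _ _ => rfl }
    change Continuous f
    refine WithSeminorms.continuous_of_isBounded (norm_withSeminorms ℂ L2) S'.withSeminorms f
      fun p => ?_
    obtain ⟨C, hC⟩ := p.2 0
    refine ⟨{0}, C.toNNReal, fun ξ => ?_⟩
    have h' : p.1 (f ξ) ≤ C * ‖ξ‖ := by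
      rw [← L2.norm_eq ξ]
      have h := hC (f ξ)
      simp only [Nat.cast_zero, neg_zero] at h
      exact h (L2.hasFiniteNorm ξ)
    refine h'.trans ?_
    simp only [Finset.sup_singleton, smul_apply, NNReal.smul_def, smul_eq_mul]
    exact mul_le_mul_of_nonneg_right (Real.le_coe_toNNReal C) (norm_nonneg ξ)

/-- The inclusion of `s` into `ℓ²`. -/
def inclS : S →L[ℂ] L2 where
  toFun ξ := ⟨ξ.toFun, S.memℓp ξ⟩
  map_add' _ _ := rfl
  map_smul' _ _ := rfl
  cont := by
    let f : S →ₗ[ℂ] L2 :=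
      { toFun := fun ξ => ⟨ξ.toFun, S.memℓp ξ⟩
        map_add' := fun _ _ => rfl
        map_smul' := fun _ _ => rfl }
    change Continuous f
    refine WithSeminorms.continuous_of_isBounded S.withSeminorms (norm_withSeminorms ℂ L2) f
      fun _ => ⟨{0}, 1, fun ξ => ?_⟩
    have h := L2.norm_eq (f ξ)
    simp only [Finset.sup_singleton, one_smul]
    exact h.symm.le

/-- The canonical embedding of `L(s', s)` into the bounded operators on `ℓ²`: the composition
`ℓ² ↪ s' → s ↪ ℓ²`. -/
def toL2 (x : L) : L2 →L[ℂ] L2 := inclS.comp (x.comp inclL2)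

/-- An operator in `L(s', s)` is infinite dimensional if, as an operator on `ℓ²`, its range is. -/
def IsInfiniteDimensional (x : L) : Prop :=
  ¬ FiniteDimensional ℂ (LinearMap.range (toL2 x).toLinearMap)

/-- An operator in `L(s', s)` is normal if it commutes with its Hilbert space adjoint. -/
def IsNormal (x : L) : Prop :=
  toL2 x * ContinuousLinearMap.adjoint (toL2 x) = ContinuousLinearMap.adjoint (toL2 x) * toL2 x

/-- A finite dimensional projection belonging to `L(s', s)`: as an operator on `ℓ²` it is an
orthogonal projection onto a finite dimensional subspace. -/
structure IsFiniteDimProjection (P : L) : Prop where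
  idem : toL2 P * toL2 P = toL2 P
  selfAdjoint : ContinuousLinearMap.adjoint (toL2 P) = toL2 P
  finiteDim : FiniteDimensional ℂ (LinearMap.range (toL2 P).toLinearMap)

/-- The series `∑ y n` converges absolutely in `L(s', s)`, with sum `x`, with respect to the
fundamental system of norms `‖·‖_q`. -/
def HasAbsSum (y : ℕ → L) (x : L) : Prop :=
  ∀ q : ℕ, (Summable fun n => opNorm q (y n)) ∧
    Tendsto (fun N : ℕ => opNorm q (x - ∑ n ∈ Finset.range N, y n)) atTop (𝓝 0)

/-- `x = ∑ lam n • P n` is a spectral representation of `x` in `L(s', s)`. -/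
structure IsSpectralRepresentation (x : L) (lam : ℕ → ℂ) (P : ℕ → L) : Prop where
  lam_mem : lam ∈ rapidSubmodule
  lam_ne_zero : ∀ n, lam n ≠ 0
  lam_distinct : ∀ m n, m ≠ n → lam m ≠ lam n
  lam_decreasing : ∀ m n, m ≤ n → ‖lam n‖ ≤ ‖lam m‖
  proj : ∀ n, IsFiniteDimProjection (P n)
  proj_ne_zero : ∀ n, P n ≠ 0
  proj_orthogonal : ∀ m n, m ≠ n → toL2 (P m) * toL2 (P n) = 0
  hasAbsSum : HasAbsSum (fun n => lam n • P n) x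

end SmoothOp

end

/-! On `ℓ²` the operator is compact and normal, so it is diagonalised by the orthogonal projections
onto its eigenspaces. What must be shown is that eigenvalues and projections are controlled in every
norm of `L(s', s)`. Up to a loss of two powers of the weights these norms are suprema of weighted
matrix entries (`norm_entry_mul_le`, `opNorm_le_of_entry_le`), so estimates of entries suffice.

Two estimates carry the proof. Both combine the fast decay of `‖x e_j‖` in `j` with an a priori
bound by `1`, which allows roots to be taken. If `P x = μ P`, then `|μ| ‖P e_j‖ ≤ ‖x e_j‖` and `‖P
e_j‖ ≤ 1`; this gives `‖P‖_q ≤ C |μ|^(-2/m)` with `m` as large as desired (`exists_opNorm_proj_le`).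
The same device with Bessel's inequality bounds the number of eigenvalues of modulus at least `ε` by
a constant times `ε^(-1/k)` (`exists_card_pow_mul_le`), so the eigenvalues decrease rapidly.
Together they yield absolute convergence and the final assertion.

Uniqueness is algebraic: in any spectral representation the coefficients are exactly the nonzero
eigenvalues, and `P n` fixes exactly the eigenspace of `lam n`. -/

namespace SmoothOp

/-! ### Coordinates and weighted norms -/

/-- The sum `∑ j, (j+1)⁻²`. -/
noncomputable def invSqSum : ℝ := ∑' j : ℕ, (((j : ℝ) + 1) ^ 2)⁻¹

theorem summable_invSq : Summable fun j : ℕ => (((j : ℝ) + 1) ^ 2)⁻¹ := by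
  have h := (summable_nat_add_iff 1).2 (Real.summable_nat_pow_inv.2 (by norm_num : 1 < 2))
  simpa using h

theorem invSqSum_nonneg : 0 ≤ invSqSum := tsum_nonneg fun _ => by positivity

theorem wnorm_nonneg (k : ℤ) (ξ : ℕ → ℂ) : 0 ≤ wnorm k ξ := Real.sqrt_nonneg _

theorem norm_apply_mul_le_wnorm {k : ℤ} {ξ : ℕ → ℂ} (h : HasFiniteNorm k ξ) (j : ℕ) :
    ‖ξ j‖ * ((j : ℝ) + 1) ^ k ≤ wnorm k ξ := by
  refine Real.le_sqrt_of_sq_le ?_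
  have h1 := h.le_tsum j fun i _ => by positivity
  rwa [mul_pow, ← zpow_natCast (_ ^ k), ← zpow_mul, mul_comm k]

/-- One extra power of the weight turns a supremum bound into an `ℓ²` bound, since `∑ (j+1)⁻²`
converges. -/
theorem hasFiniteNorm_and_wnorm_le {k : ℤ} {ξ : ℕ → ℂ} {B : ℝ}
    (h : ∀ j : ℕ, ‖ξ j‖ * ((j : ℝ) + 1) ^ (k + 1) ≤ B) :
    HasFiniteNorm k ξ ∧ wnorm k ξ ≤ B * √invSqSum := by
  have hB : 0 ≤ B := le_trans (by positivity) (h 0)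
  have key : ∀ j : ℕ, ‖ξ j‖ ^ 2 * ((j : ℝ) + 1) ^ (2 * k) ≤ B ^ 2 * (((j : ℝ) + 1) ^ 2)⁻¹ := by
    intro j
    have hj : (0 : ℝ) < (j : ℝ) + 1 := by positivity
    rw [← div_eq_mul_inv, le_div_iff₀ (by positivity)]
    refine le_trans (le_of_eq ?_) (pow_le_pow_left₀ (by positivity) (h j) 2)
    rw [zpow_add_one₀ hj.ne', mul_comm 2 k, zpow_mul, zpow_ofNat]
    ring
  have hs := summable_invSq.mul_left (B ^ 2)
  have hf : HasFiniteNorm k ξ := Summable.of_nonneg_of_le (fun j => by positivity) key hs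
  refine ⟨hf, ?_⟩
  rw [wnorm, Real.sqrt_le_left (by positivity), mul_pow, Real.sq_sqrt invSqSum_nonneg, invSqSum,
    ← tsum_mul_left]
  exact hf.tsum_le_tsum key hs

theorem mem_rapidSubmodule_of_bound {ξ : ℕ → ℂ}
    (h : ∀ p : ℕ, ∃ B : ℝ, ∀ j : ℕ, ‖ξ j‖ * ((j : ℝ) + 1) ^ p ≤ B) : ξ ∈ rapidSubmodule := by
  intro q
  obtain ⟨B, hB⟩ := h (q + 1)
  exact (hasFiniteNorm_and_wnorm_le (B := B) fun j => by exact_mod_cast hB j).1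

theorem bound_of_mem_rapidSubmodule {ξ : ℕ → ℂ} (h : ξ ∈ rapidSubmodule) (p j : ℕ) :
    ‖ξ j‖ * ((j : ℝ) + 1) ^ p ≤ wnorm p ξ := by
  exact_mod_cast norm_apply_mul_le_wnorm (h p) j

theorem wnorm_mono {k l : ℤ} (hkl : l ≤ k) {ξ : ℕ → ℂ} (h : HasFiniteNorm k ξ) :
    wnorm l ξ ≤ wnorm k ξ := by
  refine Real.sqrt_le_sqrt ((h.mono hkl).tsum_le_tsum (fun j => ?_) h)
  have h1 : (1 : ℝ) ≤ (j : ℝ) + 1 := by linarith [Nat.cast_nonneg (α := ℝ) j]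
  exact mul_le_mul_of_nonneg_left (zpow_le_zpow_right₀ h1 (by omega)) (by positivity)

theorem norm_apply_mul_pow_le (ξ : S) (q i : ℕ) :
    ‖ξ.toFun i‖ * ((i : ℝ) + 1) ^ q ≤ wnorm q ξ.toFun := by
  exact_mod_cast norm_apply_mul_le_wnorm (ξ.hasFiniteNorm q) i

theorem S.toFun_injective : Function.Injective S.toFun := Subtype.val_injective

theorem S'.toFun_injective : Function.Injective S'.toFun := Subtype.val_injective

/-! ### The norms of `L(s', s)` -/

theorem opNorm_nonneg (q : ℕ) (x : L) : 0 ≤ opNorm q x := by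
  refine (wnorm_nonneg q (x 0).toFun).trans ((isLUB_opNorm q x).1 ⟨0, ?_, ?_, rfl⟩)
  · rw [map_zero]; exact hasFiniteNorm_zero _
  · rw [map_zero]; simp [wnorm]

theorem wnorm_apply_le (q : ℕ) (x : L) {ξ : S'} (h : HasFiniteNorm (-(q : ℤ)) ξ.toFun) :
    wnorm q (x ξ).toFun ≤ opNorm q x * wnorm (-(q : ℤ)) ξ.toFun := by
  -- The supremum runs over the unit ball, so `ξ` is rescaled; this needs the degenerate case, where
  -- norm zero forces `ξ = 0`.
  obtain h0 | h0 := (wnorm_nonneg (-(q : ℤ)) ξ.toFun).eq_or_lt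
  · have hξ : ξ = 0 := by
      apply S'.toFun_injective
      rw [map_zero]
      ext j
      have h1 := norm_apply_mul_le_wnorm h j
      rw [← h0] at h1
      have h2 : (0 : ℝ) < ((j : ℝ) + 1) ^ (-(q : ℤ)) := by positivity
      simpa using nonpos_of_mul_nonpos_left h1 h2
    rw [hξ, map_zero, map_zero]
    simp [wnorm]
  · set w := wnorm (-(q : ℤ)) ξ.toFun
    have h1 : wnorm q (x (((w⁻¹ : ℝ) : ℂ) • ξ)).toFun ≤ opNorm q x := by
      refine (isLUB_opNorm q x).1 ⟨_, ?_, ?_, rfl⟩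
      · rw [map_smul]; exact h.smul _
      · rw [map_smul, wnorm_smul _ h, Complex.norm_real, norm_inv, Real.norm_of_nonneg h0.le]
        exact (inv_mul_cancel₀ h0.ne').le
    rw [map_smul, map_smul, wnorm_smul _ ((x ξ).hasFiniteNorm q), Complex.norm_real, norm_inv,
      Real.norm_of_nonneg h0.le, inv_mul_le_iff₀ h0] at h1
    linarith

theorem opNorm_le_of_forall {q : ℕ} {x : L} {B : ℝ} (hB : 0 ≤ B)
    (h : ∀ ξ : S', HasFiniteNorm (-(q : ℤ)) ξ.toFun →
      wnorm q (x ξ).toFun ≤ B * wnorm (-(q : ℤ)) ξ.toFun) : opNorm q x ≤ B := by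
  refine (isLUB_opNorm q x).2 ?_
  rintro t ⟨ξ, h1, h2, rfl⟩
  exact (h ξ h1).trans (mul_le_of_le_one_right hB h2)

theorem opNorm_smul (q : ℕ) (c : ℂ) (x : L) : opNorm q (c • x) = ‖c‖ * opNorm q x := by
  have key : ∀ (c : ℂ) (x : L), opNorm q (c • x) ≤ ‖c‖ * opNorm q x := fun c x =>
    opNorm_le_of_forall (mul_nonneg (norm_nonneg _) (opNorm_nonneg _ _)) fun ξ h => by
      rw [smul_apply, map_smul, wnorm_smul _ ((x ξ).hasFiniteNorm q), mul_assoc]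
      exact mul_le_mul_of_nonneg_left (wnorm_apply_le q x h) (norm_nonneg _)
  refine (key c x).antisymm ?_
  obtain rfl | hc := eq_or_ne c 0
  · simpa using opNorm_nonneg q _
  · have h := key c⁻¹ (c • x)
    rw [inv_smul_smul₀ hc, norm_inv, ← div_eq_inv_mul, le_div_iff₀ (norm_pos_iff.2 hc)] at h
    linarith

/-! ### Matrix entries -/

/-- The standard basis of `ℓ²`. -/
noncomputable def basisVec (j : ℕ) : L2 := lp.single 2 j (1 : ℂ)

theorem basisVec_apply (j i : ℕ) : basisVec j i = if i = j then 1 else 0 := by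
  rw [basisVec, lp.single_apply, Pi.single_apply]

theorem norm_basisVec (j : ℕ) : ‖basisVec j‖ = 1 := by
  rw [basisVec, lp.norm_single (by norm_num), norm_one]

theorem inner_basisVec_left (j : ℕ) (v : L2) : inner ℂ (basisVec j) v = v j := by
  rw [basisVec, lp.inner_single_left]; simp

theorem toFun_inclL2 (v : L2) : (inclL2 v).toFun = v := rfl

theorem toL2_apply (x : L) (v : L2) (i : ℕ) : toL2 x v i = (x (inclL2 v)).toFun i := rfl

theorem hasFiniteNorm_inclL2 (q : ℕ) (v : L2) : HasFiniteNorm (-(q : ℤ)) (inclL2 v).toFun :=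
  (L2.hasFiniteNorm v).mono (by simp)

theorem wnorm_basisVec (k : ℤ) (j : ℕ) : wnorm k (basisVec j) = ((j : ℝ) + 1) ^ k := by
  have hj : (0 : ℝ) < (j : ℝ) + 1 := by positivity
  rw [wnorm, tsum_eq_single j, basisVec_apply, mul_comm 2 k, zpow_mul, zpow_ofNat]
  · simp only [if_true, norm_one, one_pow, one_mul]
    exact Real.sqrt_sq (by positivity)
  · intro i hi
    simp [basisVec_apply, hi]

theorem norm_inclS_le (ξ : S) (q : ℕ) : ‖inclS ξ‖ ≤ wnorm q ξ.toFun := by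
  rw [← L2.norm_eq]
  exact wnorm_mono (by simp) (ξ.hasFiniteNorm q)

/-- The basis vector `e_j` has dual norm `(j+1)^(-q)`, so the columns of the matrix of `x` decay
faster than any power. -/
theorem norm_toL2_basisVec_le (x : L) (q j : ℕ) :
    ‖toL2 x (basisVec j)‖ ≤ opNorm q x * ((((j : ℝ) + 1) ^ q)⁻¹) := by
  refine (norm_inclS_le (x (inclL2 (basisVec j))) q).trans ?_
  refine (wnorm_apply_le q x (hasFiniteNorm_inclL2 q _)).trans (le_of_eq ?_)
  rw [toFun_inclL2, wnorm_basisVec, zpow_neg, zpow_natCast]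

theorem norm_entry_mul_le (x : L) (q i j : ℕ) :
    ‖toL2 x (basisVec j) i‖ * ((i : ℝ) + 1) ^ q * ((j : ℝ) + 1) ^ q ≤ opNorm q x := by
  rw [toL2_apply, ← le_div_iff₀ (by positivity)]
  refine (norm_apply_mul_pow_le _ q i).trans ?_
  refine (wnorm_apply_le q x (hasFiniteNorm_inclL2 q _)).trans (le_of_eq ?_)
  rw [toFun_inclL2, wnorm_basisVec, zpow_neg, zpow_natCast, div_eq_mul_inv]

/-- The truncation of a slowly increasing sequence to its first terms. -/
noncomputable def truncS' (J : ℕ) (ξ : S') : S' :=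
  ∑ j ∈ Finset.range J, ξ.toFun j • inclL2 (basisVec j)

theorem toFun_truncS' (J : ℕ) (ξ : S') (k : ℕ) :
    (truncS' J ξ).toFun k = if k < J then ξ.toFun k else 0 := by
  simp [truncS', map_sum, map_smul, toFun_inclL2, Finset.sum_apply, basisVec_apply]

theorem wnorm_sub_truncS'_le (J q : ℕ) {ξ : S'} (h : HasFiniteNorm (-(q : ℤ)) ξ.toFun) :
    HasFiniteNorm (-((q + 2 : ℕ) : ℤ)) (ξ - truncS' J ξ).toFun ∧
      wnorm (-((q + 2 : ℕ) : ℤ)) (ξ - truncS' J ξ).toFun ≤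
        wnorm (-(q : ℤ)) ξ.toFun / ((J : ℝ) + 1) * √invSqSum := by
  refine hasFiniteNorm_and_wnorm_le fun k => ?_
  have hk : (0 : ℝ) < (k : ℝ) + 1 := by positivity
  rw [map_sub, Pi.sub_apply, toFun_truncS']
  split_ifs with hJ
  · simpa using div_nonneg (wnorm_nonneg _ _) (by positivity)
  · rw [sub_zero, le_div_iff₀ (by positivity)]
    refine le_trans ?_ (norm_apply_mul_le_wnorm h k)
    rw [mul_assoc]
    refine mul_le_mul_of_nonneg_left ?_ (norm_nonneg _)
    have h1 : (-((q + 2 : ℕ) : ℤ) + 1) = -(q : ℤ) - 1 := by push_cast; ring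
    rw [h1, zpow_sub_one₀ hk.ne', mul_assoc]
    refine mul_le_of_le_one_right (by positivity) ?_
    rw [inv_mul_le_iff₀ hk, mul_one]
    have : (J : ℝ) ≤ k := by exact_mod_cast not_lt.1 hJ
    linarith

/-- On truncations of `ξ` the coordinate is a finite sum of entries, estimated directly. The
truncations converge to `ξ` in the weaker dual norm of index `q + 2`, for which `x` is still
bounded, so the estimate passes to the limit. -/
theorem norm_coord_mul_le_of_entry_le {x : L} {q i : ℕ} {B : ℝ}
    (hB : ∀ j : ℕ, ‖toL2 x (basisVec j) i‖ * ((i : ℝ) + 1) ^ (q + 2) * ((j : ℝ) + 1) ^ (q + 2) ≤ B)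
    {ξ : S'} (h : HasFiniteNorm (-(q : ℤ)) ξ.toFun) :
    ‖(x ξ).toFun i‖ * ((i : ℝ) + 1) ^ (q + 2) ≤ invSqSum * B * wnorm (-(q : ℤ)) ξ.toFun := by
  set w := wnorm (-(q : ℤ)) ξ.toFun
  have hw : 0 ≤ w := wnorm_nonneg _ _
  have hB0 : 0 ≤ B := le_trans (by positivity) (hB 0)
  have hi : (0 : ℝ) < ((i : ℝ) + 1) ^ (q + 2) := by positivity
  have htrunc : ∀ J : ℕ, ‖(x (truncS' J ξ)).toFun i‖ * ((i : ℝ) + 1) ^ (q + 2) ≤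
      invSqSum * B * w := by
    intro J
    have h1 : (x (truncS' J ξ)).toFun i =
        ∑ j ∈ Finset.range J, ξ.toFun j * toL2 x (basisVec j) i := by
      simp [truncS', map_sum, map_smul, Finset.sum_apply, toL2_apply]
    rw [h1]
    refine (mul_le_mul_of_nonneg_right (norm_sum_le _ _) hi.le).trans ?_
    rw [Finset.sum_mul]
    have h2 : ∀ j ∈ Finset.range J,
        ‖ξ.toFun j * toL2 x (basisVec j) i‖ * ((i : ℝ) + 1) ^ (q + 2) ≤
          (((j : ℝ) + 1) ^ 2)⁻¹ * (B * w) := by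
      intro j _
      have hj : (0 : ℝ) < (j : ℝ) + 1 := by positivity
      have h3 := norm_apply_mul_le_wnorm h j
      rw [zpow_neg, zpow_natCast, ← div_eq_mul_inv, div_le_iff₀ (by positivity)] at h3
      rw [inv_mul_eq_div, le_div_iff₀ (by positivity), norm_mul]
      calc _ = ‖ξ.toFun j‖ * (‖toL2 x (basisVec j) i‖ * ((i : ℝ) + 1) ^ (q + 2) *
            ((j : ℝ) + 1) ^ 2) := by ring
        _ ≤ (w * ((j : ℝ) + 1) ^ q) * (‖toL2 x (basisVec j) i‖ * ((i : ℝ) + 1) ^ (q + 2) *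
            ((j : ℝ) + 1) ^ 2) := mul_le_mul_of_nonneg_right h3 (by positivity)
        _ = w * (‖toL2 x (basisVec j) i‖ * ((i : ℝ) + 1) ^ (q + 2) *
            ((j : ℝ) + 1) ^ (q + 2)) := by ring
        _ ≤ w * B := mul_le_mul_of_nonneg_left (hB j) hw
        _ = B * w := mul_comm _ _
    refine (Finset.sum_le_sum h2).trans ?_
    rw [← Finset.sum_mul, mul_assoc]
    refine mul_le_mul_of_nonneg_right ?_ (by positivity)
    exact summable_invSq.sum_le_tsum _ fun _ _ => by positivity
  have hlim : Tendsto (fun J : ℕ => invSqSum * B * w +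
      opNorm (q + 2) x * (w * √invSqSum) * (1 / ((J : ℝ) + 1))) atTop
      (𝓝 (invSqSum * B * w + opNorm (q + 2) x * (w * √invSqSum) * 0)) :=
    tendsto_const_nhds.add (tendsto_const_nhds.mul tendsto_one_div_add_atTop_nhds_zero_nat)
  rw [mul_zero, add_zero] at hlim
  refine ge_of_tendsto' hlim fun J => ?_
  obtain ⟨h3, h4⟩ := wnorm_sub_truncS'_le J q h
  have h5 := (norm_apply_mul_pow_le _ (q + 2) i).trans (wnorm_apply_le (q + 2) x h3)
  have h6 := h5.trans (mul_le_mul_of_nonneg_left h4 (opNorm_nonneg _ _))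
  have h7 : (x ξ).toFun i = (x (truncS' J ξ)).toFun i + (x (ξ - truncS' J ξ)).toFun i := by
    rw [map_sub, map_sub]; simp
  rw [h7]
  refine (mul_le_mul_of_nonneg_right (norm_add_le _ _) hi.le).trans ?_
  rw [add_mul]
  refine add_le_add (htrunc J) (h6.trans (le_of_eq ?_))
  ring

theorem opNorm_le_of_entry_le {x : L} {q : ℕ} {B : ℝ}
    (hB : ∀ i j : ℕ,
      ‖toL2 x (basisVec j) i‖ * ((i : ℝ) + 1) ^ (q + 2) * ((j : ℝ) + 1) ^ (q + 2) ≤ B) :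
    opNorm q x ≤ invSqSum * √invSqSum * B := by
  have hB0 : 0 ≤ B := le_trans (by positivity) (hB 0 0)
  have hZ := invSqSum_nonneg
  refine opNorm_le_of_forall (by positivity) fun ξ h => ?_
  have hw := wnorm_nonneg (-(q : ℤ)) ξ.toFun
  refine (hasFiniteNorm_and_wnorm_le (B := invSqSum * B * wnorm (-(q : ℤ)) ξ.toFun)
    fun i => ?_).2.trans (le_of_eq (by ring))
  have h1 := norm_coord_mul_le_of_entry_le (hB i) h
  refine le_trans ?_ h1
  have h2 : ((i : ℝ) + 1) ^ ((q : ℤ) + 1) = ((i : ℝ) + 1) ^ (q + 1) := by norm_cast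
  rw [h2]
  refine mul_le_mul_of_nonneg_left (pow_le_pow_right₀ ?_ (by omega)) (norm_nonneg _)
  linarith [Nat.cast_nonneg (α := ℝ) i]

/-! ### Linearity, injectivity and continuity of the embedding into bounded operators on `ℓ²`. -/

theorem toL2_zero : toL2 0 = 0 := by
  rw [toL2, ContinuousLinearMap.zero_comp, ContinuousLinearMap.comp_zero]

theorem toL2_add (x y : L) : toL2 (x + y) = toL2 x + toL2 y := by
  rw [toL2, ContinuousLinearMap.add_comp, ContinuousLinearMap.comp_add]; rfl

theorem toL2_smul (c : ℂ) (x : L) : toL2 (c • x) = c • toL2 x := by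
  rw [toL2, ContinuousLinearMap.smul_comp, ContinuousLinearMap.comp_smul]; rfl

/-- The embedding `toL2` as a linear map. -/
noncomputable def toL2ₗ : L →ₗ[ℂ] (L2 →L[ℂ] L2) where
  toFun := toL2
  map_add' := toL2_add
  map_smul' := toL2_smul

theorem toL2_sub (x y : L) : toL2 (x - y) = toL2 x - toL2 y := map_sub toL2ₗ x y

theorem toL2_sum {ι : Type*} (s : Finset ι) (y : ι → L) :
    toL2 (∑ n ∈ s, y n) = ∑ n ∈ s, toL2 (y n) := map_sum toL2ₗ y s

theorem eq_zero_of_toL2_eq_zero {x : L} (hx : toL2 x = 0) : x = 0 := by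
  ext ξ
  obtain ⟨q, hq⟩ := ξ.2
  apply S.toFun_injective
  ext i
  -- All entries vanish, so the entry bound holds with `B = 0` and kills every coordinate on all of
  -- `s'`.
  have h := norm_coord_mul_le_of_entry_le (x := x) (i := i) (B := 0) (fun j => by simp [hx]) hq
  rw [mul_zero, zero_mul] at h
  simpa using nonpos_of_mul_nonpos_left h (by positivity)

theorem toL2_injective : Function.Injective toL2 := fun x y h => by
  rw [← sub_eq_zero]
  exact eq_zero_of_toL2_eq_zero (by rw [toL2_sub, h, sub_self])

theorem norm_toL2_le (x : L) : ‖toL2 x‖ ≤ opNorm 0 x := by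
  refine ContinuousLinearMap.opNorm_le_bound _ (opNorm_nonneg _ _) fun v => ?_
  have h := wnorm_apply_le 0 x (hasFiniteNorm_inclL2 0 v)
  refine (norm_inclS_le (x (inclL2 v)) 0).trans (h.trans (le_of_eq ?_))
  rw [toFun_inclL2, Nat.cast_zero, neg_zero, L2.norm_eq]

end SmoothOp

namespace SmoothOp

open ContinuousLinearMap (adjoint)

/-! ### Quantitative estimates for projections and eigenvalues -/

theorem norm_apply_le_of_projection {H : Type*} [NormedAddCommGroup H] [InnerProductSpace ℂ H]
    [CompleteSpace H] {P : H →L[ℂ] H} (hidem : P * P = P) (hself : adjoint P = P) (v : H) :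
    ‖P v‖ ≤ ‖v‖ := by
  have h1 : ‖P v‖ * ‖P v‖ ≤ ‖P v‖ * ‖v‖ := by
    have h2 : inner ℂ (P v) (P v) = inner ℂ (P v) v := by
      rw [← ContinuousLinearMap.adjoint_inner_left P v (P v), hself,
        ← mul_apply_eq_comp, hidem]
    calc ‖P v‖ * ‖P v‖ = ‖inner ℂ (P v) (P v)‖ := by rw [inner_self_eq_norm_sq_to_K]; simp [pow_two]
      _ = ‖inner ℂ (P v) v‖ := by rw [h2]
      _ ≤ _ := norm_inner_le_norm _ _
  obtain h0 | h0 := (norm_nonneg (P v)).eq_or_lt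
  · rw [← h0]; exact norm_nonneg v
  · exact le_of_mul_le_mul_left h1 h0

/-- The constant depends only on `x`, `q` and `m`, and the power of `1/|μ|` can be made arbitrarily
small by taking the norm of `x` at index `m * (q + 2)`. -/
theorem exists_opNorm_proj_le (x : L) (q : ℕ) {m : ℕ} (hm : 0 < m) :
    ∃ C : ℝ, 0 ≤ C ∧ ∀ (P : L) (μ : ℂ), μ ≠ 0 → toL2 P * toL2 P = toL2 P →
      adjoint (toL2 P) = toL2 P → toL2 P * toL2 x = μ • toL2 P →
      opNorm q P ≤ C * ‖μ‖ ^ (-(2 / m : ℝ)) := by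
  set D := opNorm (m * (q + 2)) x
  have hD : 0 ≤ D := opNorm_nonneg _ _
  have hZ := invSqSum_nonneg
  refine ⟨invSqSum * √invSqSum * D ^ (2 / m : ℝ), by positivity,
    fun P μ hμ hidem hself hPx => ?_⟩
  have hμ0 : 0 < ‖μ‖ := norm_pos_iff.2 hμ
  have hm' : (m : ℝ) ≠ 0 := by positivity
  set b : ℝ := (D / ‖μ‖) ^ (1 / m : ℝ)
  have hb : 0 ≤ b := by positivity
  have hcol : ∀ j : ℕ, ‖toL2 P (basisVec j)‖ * ((j : ℝ) + 1) ^ (q + 2) ≤ b := by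
    intro j
    set a := ‖toL2 P (basisVec j)‖
    have ha0 : 0 ≤ a := norm_nonneg _
    have ha1 : a ≤ 1 := by
      simpa [norm_basisVec] using norm_apply_le_of_projection hidem hself (basisVec j)
    have ha : a ≤ D / ‖μ‖ * ((((j : ℝ) + 1) ^ (m * (q + 2)))⁻¹) := by
      rw [div_mul_eq_mul_div, le_div_iff₀ hμ0, mul_comm a, ← norm_smul, ← smul_apply, ← hPx,
        mul_apply_eq_comp]
      exact (norm_apply_le_of_projection hidem hself _).trans (norm_toL2_basisVec_le x _ j)
    rw [← div_eq_mul_inv, le_div_iff₀ (by positivity)] at ha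
    -- Since `0 ≤ a ≤ 1`, `a ^ m ≤ a`; this is what permits an `m`-th root of the decay estimate.
    have hpow : (a * ((j : ℝ) + 1) ^ (q + 2)) ^ m ≤ D / ‖μ‖ := by
      rw [mul_pow, ← pow_mul, mul_comm (q + 2) m]
      exact (mul_le_mul_of_nonneg_right (pow_le_of_le_one ha0 ha1 hm.ne')
        (by positivity)).trans ha
    have h1 := Real.rpow_le_rpow (by positivity) hpow (by positivity : (0 : ℝ) ≤ 1 / m)
    rwa [one_div, Real.pow_rpow_inv_natCast (by positivity) hm.ne', ← one_div] at h1
  have hent : ∀ i j : ℕ, ‖toL2 P (basisVec j) i‖ * ((i : ℝ) + 1) ^ (q + 2) *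
      ((j : ℝ) + 1) ^ (q + 2) ≤ b * b := by
    intro i j
    -- From `P = P* P`, an entry is bounded by the product of two column norms, hence the exponent
    -- `2/m`.
    have h1 : toL2 P (basisVec j) i = inner ℂ (toL2 P (basisVec i)) (toL2 P (basisVec j)) := by
      rw [← ContinuousLinearMap.adjoint_inner_right, hself,
        ← mul_apply_eq_comp, hidem, inner_basisVec_left]
    rw [h1]
    calc _ ≤ ‖toL2 P (basisVec i)‖ * ‖toL2 P (basisVec j)‖ * ((i : ℝ) + 1) ^ (q + 2) *
          ((j : ℝ) + 1) ^ (q + 2) := by gcongr; exact norm_inner_le_norm _ _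
      _ = (‖toL2 P (basisVec i)‖ * ((i : ℝ) + 1) ^ (q + 2)) *
          (‖toL2 P (basisVec j)‖ * ((j : ℝ) + 1) ^ (q + 2)) := by ring
      _ ≤ b * b := mul_le_mul (hcol i) (hcol j) (by positivity) hb
  refine (opNorm_le_of_entry_le hent).trans (le_of_eq ?_)
  have h2 : b * b = D ^ (2 / m : ℝ) * ‖μ‖ ^ (-(2 / m : ℝ)) := by
    rw [← pow_two, ← Real.rpow_natCast b 2, ← Real.rpow_mul (by positivity),
      Real.div_rpow hD hμ0.le, Real.rpow_neg hμ0.le, div_eq_mul_inv]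
    norm_num
    ring_nf
  rw [h2]; ring

/-- The cardinality is the sum over `j` of `∑ i, |f i j|²`, the squared norm of the projection of
`e_j` onto the span of the `f i`. Bessel's inequality applied to `e_j` and to `x e_j` bounds this
term by `1` and by a rapidly decaying quantity; a `k`-th root between the two is summable. -/
theorem exists_card_pow_mul_le (x : L) {k : ℕ} (hk : 0 < k) :
    ∃ C : ℝ, ∀ {ι : Type} [Fintype ι] (f : ι → L2) (μ : ι → ℂ) (ε : ℝ), Orthonormal ℂ f → 0 < ε →
      (∀ i, adjoint (toL2 x) (f i) = μ i • f i) → (∀ i, ε ≤ ‖μ i‖) →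
      (Fintype.card ι : ℝ) ^ k * ε ≤ C := by
  set D := opNorm (2 * k) x
  have hD : 0 ≤ D := opNorm_nonneg _ _
  have hZ := invSqSum_nonneg
  refine ⟨invSqSum ^ k * D, fun {ι} _ f μ ε hf hε heig hμ => ?_⟩
  set b : ℝ := (D / ε) ^ (1 / k : ℝ)
  have hb : 0 ≤ b := by positivity
  have hinner : ∀ i j, ‖inner ℂ (f i) (basisVec j)‖ = ‖f i j‖ := fun i j => by
    rw [norm_inner_symm, inner_basisVec_left]
  have hg : ∀ j : ℕ, ∑ i, ‖f i j‖ ^ 2 ≤ (((j : ℝ) + 1) ^ 2)⁻¹ * b := by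
    intro j
    set g := ∑ i, ‖f i j‖ ^ 2
    have hg0 : 0 ≤ g := Finset.sum_nonneg fun _ _ => by positivity
    have hg1 : g ≤ 1 := by
      have h := hf.sum_inner_products_le (basisVec j) (s := Finset.univ)
      simpa only [hinner, norm_basisVec, one_pow] using h
    have hg2 : (ε * √g) ≤ D * ((((j : ℝ) + 1) ^ (2 * k))⁻¹) := by
      refine le_trans ?_ (norm_toL2_basisVec_le x (2 * k) j)
      refine abs_le_of_sq_le_sq' ?_ (norm_nonneg _) |>.2
      rw [mul_pow, Real.sq_sqrt hg0]
      refine le_trans ?_ (hf.sum_inner_products_le (toL2 x (basisVec j)) (s := Finset.univ))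
      rw [Finset.mul_sum]
      refine Finset.sum_le_sum fun i _ => ?_
      rw [← ContinuousLinearMap.adjoint_inner_left, heig, inner_smul_left, norm_mul,
        RCLike.norm_conj, hinner, mul_pow]
      exact mul_le_mul_of_nonneg_right (pow_le_pow_left₀ hε.le (hμ i) 2) (by positivity)
    rw [← div_eq_mul_inv, le_div_iff₀ (by positivity)] at hg2
    have hg3 : g ^ k ≤ √g := by
      refine (pow_le_of_le_one hg0 hg1 hk.ne').trans (Real.le_sqrt_of_sq_le ?_)
      exact pow_le_of_le_one hg0 hg1 two_ne_zero
    have hpow : (g * ((j : ℝ) + 1) ^ 2) ^ k ≤ D / ε := by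
      rw [mul_pow, ← pow_mul, le_div_iff₀ hε]
      refine le_trans (le_trans (mul_le_mul_of_nonneg_right
        (mul_le_mul_of_nonneg_right hg3 (by positivity)) hε.le) (le_of_eq ?_)) hg2
      ring
    have h1 := Real.rpow_le_rpow (by positivity) hpow (by positivity : (0 : ℝ) ≤ 1 / k)
    rw [one_div, Real.pow_rpow_inv_natCast (by positivity) hk.ne', ← one_div] at h1
    rwa [inv_mul_eq_div, le_div_iff₀ (by positivity)]
  have hsum : HasSum (fun j : ℕ => ∑ i, ‖f i j‖ ^ 2) (Fintype.card ι : ℝ) := by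
    have h1 : ∀ i ∈ (Finset.univ : Finset ι), HasSum (fun j : ℕ => ‖f i j‖ ^ 2) 1 := by
      intro i _
      have h := lp.hasSum_norm (p := 2) (by norm_num) (f i)
      rw [hf.1 i] at h
      simpa using h
    simpa using hasSum_sum h1
  have hcard : (Fintype.card ι : ℝ) ≤ invSqSum * b :=
    hasSum_le hg hsum (summable_invSq.hasSum.mul_right b)
  have h2 := pow_le_pow_left₀ (by positivity) hcard k
  rw [mul_pow, ← Real.rpow_natCast b k, ← Real.rpow_mul (by positivity),
    one_div_mul_cancel (by positivity), Real.rpow_one] at h2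
  refine (mul_le_mul_of_nonneg_right h2 hε.le).trans (le_of_eq ?_)
  field_simp

end SmoothOp

namespace SmoothOp

open ContinuousLinearMap (adjoint)
open Module.End (eigenspace HasEigenvalue mem_eigenspace_iff hasEigenvalue_iff)

/-! ### Compact normal operators on a Hilbert space -/

section Hilbert

variable {H : Type*} [NormedAddCommGroup H] [InnerProductSpace ℂ H] [CompleteSpace H]
  {T : H →L[ℂ] H}

/-- `T - μ` is again normal, and a normal operator has the same kernel as its adjoint. -/
theorem adjoint_apply_of_apply_eq_smul (hT : IsStarNormal T) {μ : ℂ} {v : H} (h : T v = μ • v) :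
    adjoint T v = (starRingEnd ℂ) μ • v := by
  have hN : IsStarNormal (T - μ • 1) := by
    refine ContinuousLinearMap.isStarNormal_iff_norm_eq_adjoint.2 fun w => ?_
    have h1 := ContinuousLinearMap.isStarNormal_iff_norm_eq_adjoint.1 hT w
    have h2 : ‖T w - μ • w‖ ^ 2 = ‖adjoint T w - (starRingEnd ℂ) μ • w‖ ^ 2 := by
      rw [@norm_sub_sq ℂ, @norm_sub_sq ℂ, h1, norm_smul, norm_smul, RCLike.norm_conj,
        inner_smul_right, inner_smul_right, ContinuousLinearMap.adjoint_inner_left,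
        ← inner_conj_symm w (T w), ← map_mul, RCLike.conj_re]
    have h3 : adjoint (T - μ • 1) w = adjoint T w - (starRingEnd ℂ) μ • w := by
      refine ext_inner_right ℂ fun u => ?_
      rw [ContinuousLinearMap.adjoint_inner_left, inner_sub_left, inner_smul_left,
        ContinuousLinearMap.adjoint_inner_left]
      simp [inner_sub_right, inner_smul_right]
    rw [h3]
    simpa using (sq_eq_sq₀ (norm_nonneg _) (norm_nonneg _)).1 h2
  have h4 := (ContinuousLinearMap.IsStarNormal.adjoint_apply_eq_zero_iff hN v).2 (by simp [h])
  have h3 : adjoint (T - μ • 1) v = adjoint T v - (starRingEnd ℂ) μ • v := by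
    refine ext_inner_right ℂ fun u => ?_
    rw [ContinuousLinearMap.adjoint_inner_left, inner_sub_left, inner_smul_left,
      ContinuousLinearMap.adjoint_inner_left]
    simp [inner_sub_right, inner_smul_right]
  rw [h3, sub_eq_zero] at h4
  exact h4

theorem inner_eq_zero_of_apply_eq_smul (hT : IsStarNormal T) {μ ν : ℂ} (hμν : μ ≠ ν) {v w : H}
    (hv : T v = μ • v) (hw : T w = ν • w) : inner ℂ v w = 0 := by
  have h1 : inner ℂ v (T w) = μ * inner ℂ v w := by
    rw [← ContinuousLinearMap.adjoint_inner_left, adjoint_apply_of_apply_eq_smul hT hv,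
      inner_smul_left, Complex.conj_conj]
  rw [hw, inner_smul_right] at h1
  have h2 : (μ - ν) * inner ℂ v w = 0 := by rw [sub_mul, h1, sub_self]
  exact (mul_eq_zero.1 h2).resolve_left (sub_ne_zero.2 hμν)

/-- For a normal operator the norm is the spectral radius, and nonzero spectral values of a compact
operator are eigenvalues. -/
theorem eq_zero_of_forall_hasEigenvalue_eq_zero [Nontrivial H] (hc : IsCompactOperator T)
    (hT : IsStarNormal T) (h : ∀ μ, HasEigenvalue (T : Module.End ℂ H) μ → μ = 0) : T = 0 := by
  let _ : CStarAlgebra (H →L[ℂ] H) := { }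
  rw [← nnnorm_eq_zero, ← ENNReal.coe_eq_zero, ← IsStarNormal.spectralRadius_eq_nnnorm T,
    spectralRadius, ENNReal.iSup_eq_zero]
  intro μ
  rw [ENNReal.iSup_eq_zero]
  intro hμ
  by_contra h0
  have h1 : μ ≠ 0 := by simpa using h0
  exact h1 (h μ ((hc.hasEigenvalue_iff_mem_spectrum h1).2 hμ))

/-- The complement is invariant under `T` and its adjoint, so `T` restricts to a compact normal
operator without eigenvectors. That restriction must be zero, and then every nonzero vector is an
eigenvector for `0`. -/
theorem orthogonal_iSup_eigenspace_eq_bot (hc : IsCompactOperator T) (hT : IsStarNormal T) :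
    (⨆ μ, eigenspace (T : Module.End ℂ H) μ)ᗮ = ⊥ := by
  set W : Submodule ℂ H := (⨆ μ, eigenspace (T : Module.End ℂ H) μ)ᗮ
  have hmem : ∀ w, w ∈ W ↔ ∀ (μ : ℂ) (v : H), T v = μ • v → inner ℂ v w = 0 := by
    intro w
    simp only [W, ← Submodule.iInf_orthogonal, Submodule.mem_iInf, Submodule.mem_orthogonal,
      mem_eigenspace_iff]
    rfl
  have hW1 : ∀ w ∈ W, T w ∈ W := fun w hw => (hmem _).2 fun μ v hv => by
    rw [← ContinuousLinearMap.adjoint_inner_left, adjoint_apply_of_apply_eq_smul hT hv,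
      inner_smul_left, (hmem w).1 hw μ v hv, mul_zero]
  have hW2 : ∀ w ∈ W, adjoint T w ∈ W := fun w hw => (hmem _).2 fun μ v hv => by
    rw [ContinuousLinearMap.adjoint_inner_right, hv, inner_smul_left, (hmem w).1 hw μ v hv,
      mul_zero]
  by_contra hne
  have : Nontrivial W := Submodule.nontrivial_iff_ne_bot.2 hne
  let R : W →L[ℂ] W := T.restrict hW1
  have hR : ∀ w, (R w : H) = T w := fun _ => rfl
  have hadj : adjoint R = (adjoint T).restrict hW2 := by
    refine (ContinuousLinearMap.eq_adjoint_iff _ _).2 (fun v w => ?_) |>.symm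
    exact ContinuousLinearMap.adjoint_inner_left T (w : H) (v : H)
  have hRn : IsStarNormal R := ContinuousLinearMap.isStarNormal_iff_norm_eq_adjoint.2 fun w => by
    rw [hadj]
    exact ContinuousLinearMap.isStarNormal_iff_norm_eq_adjoint.1 hT (w : H)
  have hRc : IsCompactOperator R := hc.restrict' (f := (T : H →ₗ[ℂ] H)) hW1
  have hnoeig : ∀ (μ : ℂ) (w : W), R w = μ • w → w = 0 := fun μ w hw => by
    have h1 : T w = μ • (w : H) := by rw [← hR, hw]; rfl
    exact Subtype.ext (inner_self_eq_zero.1 ((hmem w).1 w.2 μ w h1))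
  have hR0 : R = 0 := eq_zero_of_forall_hasEigenvalue_eq_zero hRc hRn fun μ hμ => by
    obtain ⟨w, hw⟩ := hμ.exists_hasEigenvector
    exact absurd (hnoeig μ w hw.apply_eq_smul) hw.2
  obtain ⟨w, hw⟩ := exists_ne (0 : W)
  exact hw (hnoeig 0 w (by simp [hR0]))

/-- Eigenvectors span a dense subspace; later operator identities are therefore tested on
eigenvectors only. -/
theorem eq_of_forall_eigenvector_apply_eq (hc : IsCompactOperator T) (hT : IsStarNormal T)
    {A B : H →L[ℂ] H} (h : ∀ (μ : ℂ) (v : H), T v = μ • v → A v = B v) : A = B := by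
  have h1 : (⨆ μ, eigenspace (T : Module.End ℂ H) μ) ≤ LinearMap.ker (A - B).toLinearMap := by
    refine iSup_le fun μ v hv => ?_
    have h2 : T v = μ • v := mem_eigenspace_iff.1 hv
    simp [h μ v h2]
  have h2 := Submodule.topologicalClosure_minimal _ h1 (A - B).isClosed_ker
  rw [Submodule.topologicalClosure_eq_top_iff.2 (orthogonal_iSup_eigenspace_eq_bot hc hT)] at h2
  ext v
  have h3 : (A - B) v = 0 := h2 (Submodule.mem_top : v ∈ ⊤)
  simpa [sub_eq_zero] using h3

theorem finiteDimensional_range_of_finite_hasEigenvalue (hc : IsCompactOperator T)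
    (hT : IsStarNormal T) (hfin : {μ : ℂ | μ ≠ 0 ∧ HasEigenvalue (T : Module.End ℂ H) μ}.Finite) :
    FiniteDimensional ℂ (LinearMap.range T.toLinearMap) := by
  set E := {μ : ℂ | μ ≠ 0 ∧ HasEigenvalue (T : Module.End ℂ H) μ}
  have : Finite E := hfin
  have : ∀ μ : E, FiniteDimensional ℂ (eigenspace (T : Module.End ℂ H) (μ : ℂ)) := fun μ =>
    ContinuousLinearMap.finite_dimensional_eigenspace hc μ μ.2.1
  set V : Submodule ℂ H := ⨆ μ : E, eigenspace (T : Module.End ℂ H) (μ : ℂ)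
  suffices h : LinearMap.range T.toLinearMap ≤ V from Submodule.finiteDimensional_of_le h
  have hPT : V.starProjection * T = T := by
    refine eq_of_forall_eigenvector_apply_eq hc hT fun μ v hv => ?_
    rw [mul_apply_eq_comp, Submodule.starProjection_eq_self_iff, hv]
    by_cases hμ : μ ≠ 0 ∧ v ≠ 0
    · refine V.smul_mem _ (Submodule.mem_iSup_of_mem (⟨μ, hμ.1, ?_⟩ : E) (mem_eigenspace_iff.2 hv))
      exact Module.End.hasEigenvalue_of_hasEigenvector ⟨mem_eigenspace_iff.2 hv, hμ.2⟩
    · have : μ • v = 0 := by rw [smul_eq_zero]; tauto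
      rw [this]; exact V.zero_mem
  rintro _ ⟨v, rfl⟩
  refine Submodule.starProjection_eq_self_iff.1 ?_
  exact DFunLike.congr_fun hPT v

end Hilbert

theorem isStarNormal_toL2 {x : L} (h : IsNormal x) : IsStarNormal (toL2 x) := ⟨h.symm⟩

/-- The orthogonal projection of `ℓ²` onto the first coordinates. -/
noncomputable def truncL2 (J : ℕ) : L2 →L[ℂ] L2 :=
  ∑ j ∈ Finset.range J, (innerSL ℂ (basisVec j)).smulRight (basisVec j)

theorem truncL2_apply (J : ℕ) (v : L2) (k : ℕ) : truncL2 J v k = if k < J then v k else 0 := by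
  have h : truncL2 J v = ∑ j ∈ Finset.range J, v j • basisVec j := by
    simp [truncL2, sum_apply, inner_basisVec_left]
  rw [h, lp.coeFn_sum, Finset.sum_apply]
  simp [basisVec_apply]

theorem isCompactOperator_truncL2 (J : ℕ) : IsCompactOperator (truncL2 J) := by
  have : ∀ s : Finset ℕ, IsCompactOperator
      (∑ j ∈ s, (innerSL ℂ (basisVec j)).smulRight (basisVec j) : L2 →L[ℂ] L2) := by
    intro s
    induction s using Finset.cons_induction with
    | empty => exact isCompactOperator_zero
    | cons a s ha ih =>
      rw [Finset.sum_cons]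
      refine IsCompactOperator.add ?_ ih
      exact (isCompactOperator_of_locallyCompactSpace_dom (innerSL ℂ (basisVec a))).clm_comp
        (ContinuousLinearMap.toSpanSingleton ℂ (basisVec a))
  exact this _

theorem isCompactOperator_toL2 (x : L) : IsCompactOperator (toL2 x) := by
  have hZ := invSqSum_nonneg
  -- Of the two powers supplied by `opNorm 2 x`, one pays for the `ℓ²` sum and the other gives the
  -- rate `1/(J+1)`.
  have hbound : ∀ J : ℕ, ‖truncL2 J * toL2 x - toL2 x‖ ≤
      opNorm 2 x * √invSqSum * (1 / ((J : ℝ) + 1)) := by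
    intro J
    have hx := opNorm_nonneg 2 x
    refine ContinuousLinearMap.opNorm_le_bound _ (by positivity) fun v => ?_
    rw [← L2.norm_eq]
    refine (hasFiniteNorm_and_wnorm_le (k := 0) (B := opNorm 2 x * ‖v‖ / ((J : ℝ) + 1))
      fun k => ?_).2.trans (le_of_eq (by ring))
    have hk : (0 : ℝ) < (k : ℝ) + 1 := by positivity
    rw [zero_add, zpow_one, sub_apply, lp.coeFn_sub, Pi.sub_apply,
      mul_apply_eq_comp, truncL2_apply]
    split_ifs with hJ
    · rw [sub_self, norm_zero, zero_mul]; positivity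
    · rw [zero_sub, norm_neg, le_div_iff₀ (by positivity), toL2_apply]
      have h1 := (norm_apply_mul_pow_le (x (inclL2 v)) 2 k).trans
        (wnorm_apply_le 2 x (hasFiniteNorm_inclL2 2 v))
      have h2 : wnorm (-((2 : ℕ) : ℤ)) (inclL2 v).toFun ≤ ‖v‖ := by
        rw [← L2.norm_eq]; exact wnorm_mono (by simp) (L2.hasFiniteNorm v)
      refine le_trans ?_ (h1.trans (mul_le_mul_of_nonneg_left h2 hx))
      rw [pow_two, mul_assoc]
      have h3 : (J : ℝ) ≤ k := by exact_mod_cast not_lt.1 hJ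
      gcongr
  refine isCompactOperator_of_tendsto (l := atTop) (F := fun J : ℕ => truncL2 J * toL2 x) ?_
    (Eventually.of_forall fun J => (isCompactOperator_truncL2 J).comp_clm (toL2 x))
  rw [tendsto_iff_norm_sub_tendsto_zero]
  refine squeeze_zero (fun _ => norm_nonneg _) hbound ?_
  simpa using (tendsto_const_nhds (x := opNorm 2 x * √invSqSum)).mul
    (tendsto_one_div_add_atTop_nhds_zero_nat (𝕜 := ℝ))

/-! ### Enumeration by decreasing modulus -/

/-- Greedy choice: always take an element of largest modulus among those not yet chosen. A missed
`z` would leave infinitely many elements of modulus at least `‖z‖ > 0`. -/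
theorem exists_enumeration_antitone_norm {E : Set ℂ} (hE : E.Infinite)
    (hfin : ∀ ε : ℝ, 0 < ε → {z ∈ E | ε ≤ ‖z‖}.Finite) (h0 : (0 : ℂ) ∉ E) :
    ∃ lam : ℕ → ℂ, Function.Injective lam ∧ Set.range lam = E ∧ Antitone fun n => ‖lam n‖ := by
  classical
  have hstep : ∀ s : Finset ℂ, ∃ z ∈ E, z ∉ s ∧ ∀ w ∈ E, w ∉ s → ‖w‖ ≤ ‖z‖ := by
    intro s
    obtain ⟨z0, hz0, hz0s⟩ := hE.exists_notMem_finset s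
    have hz0' : 0 < ‖z0‖ := norm_pos_iff.2 fun h => h0 (h ▸ hz0)
    have hA : ({z ∈ E | ‖z0‖ ≤ ‖z‖} \ (s : Set ℂ)).Finite := (hfin _ hz0').subset Set.sdiff_subset
    obtain ⟨z, hz, hmax⟩ := Set.exists_max_image _ (fun z : ℂ => ‖z‖) hA
      ⟨z0, ⟨hz0, le_rfl⟩, by simpa using hz0s⟩
    refine ⟨z, hz.1.1, by simpa using hz.2, fun w hw hws => ?_⟩
    by_cases hle : ‖z0‖ ≤ ‖w‖
    · exact hmax w ⟨⟨hw, hle⟩, by simpa using hws⟩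
    · exact (not_le.1 hle).le.trans hz.1.2
  choose pick hpE hps hpmax using hstep
  let F : ℕ → Finset ℂ := fun n => Nat.rec ∅ (fun _ s => insert (pick s) s) n
  have hF : ∀ n, F (n + 1) = insert (pick (F n)) (F n) := fun _ => rfl
  have hFmono : Monotone F := monotone_nat_of_le_succ fun n => by
    rw [hF]; exact Finset.subset_insert _ _
  have hmem : ∀ m n, m < n → pick (F m) ∈ F n := fun m n hmn =>
    hFmono (Nat.succ_le_of_lt hmn) (by
      rw [Nat.succ_eq_add_one, hF]; exact Finset.mem_insert_self _ _)
  have hanti : Antitone fun n => ‖pick (F n)‖ := fun m n hmn =>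
    hpmax _ _ (hpE _) fun h => hps (F n) (hFmono hmn h)
  have hinj : Function.Injective fun n => pick (F n) := by
    refine Function.Injective.of_lt_imp_ne fun m n hmn h => hps (F n) ?_
    have h1 : pick (F m) = pick (F n) := h
    rw [← h1]
    exact hmem m n hmn
  have hFsub : ∀ n, ∀ z ∈ F n, ∃ m, pick (F m) = z := by
    intro n
    induction n with
    | zero => intro z hz; exact absurd hz (Finset.notMem_empty z)
    | succ n ih =>
      intro z hz
      rw [hF, Finset.mem_insert] at hz
      rcases hz with rfl | hz
      · exact ⟨n, rfl⟩
      · exact ih z hz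
  refine ⟨fun n => pick (F n), hinj, Set.Subset.antisymm ?_ fun z hz => ?_, hanti⟩
  · rintro _ ⟨n, rfl⟩; exact hpE _
  · by_contra hnot
    have hz0 : 0 < ‖z‖ := norm_pos_iff.2 fun h => h0 (h ▸ hz)
    refine Set.infinite_range_of_injective hinj ((hfin _ hz0).subset ?_)
    rintro _ ⟨n, rfl⟩
    refine ⟨hpE _, hpmax _ z hz fun h => hnot ?_⟩
    obtain ⟨m, hm⟩ := hFsub n z h
    exact ⟨m, hm⟩

end SmoothOp

namespace SmoothOp

open ContinuousLinearMap (adjoint)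
open Module.End (eigenspace HasEigenvalue mem_eigenspace_iff)

/-! ### Summability in `L(s', s)` -/

theorem rpow_mul_opNorm_mem_rapidSubmodule {x : L} {lam : ℕ → ℂ} {P : ℕ → L}
    (hlam : lam ∈ rapidSubmodule) (h0 : ∀ n, lam n ≠ 0)
    (hidem : ∀ n, toL2 (P n) * toL2 (P n) = toL2 (P n))
    (hself : ∀ n, adjoint (toL2 (P n)) = toL2 (P n))
    (hPx : ∀ n, toL2 (P n) * toL2 x = lam n • toL2 (P n)) (q : ℕ) {θ : ℝ} (hθ : 0 < θ) :
    (fun n => ((‖lam n‖ ^ θ * opNorm q (P n) : ℝ) : ℂ)) ∈ rapidSubmodule := by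
  -- With `2/m < θ` a positive power `|lam n|^a` survives the projection estimate, and positive
  -- powers of a rapidly decreasing sequence decrease rapidly.
  obtain ⟨m, hm⟩ := exists_nat_gt (2 / θ)
  have hm0 : (0 : ℝ) < m := lt_trans (by positivity) hm
  set a : ℝ := θ - 2 / m
  have ha : 0 < a := by
    rw [div_lt_iff₀ hθ] at hm
    rw [sub_pos, div_lt_iff₀ hm0]
    linarith
  obtain ⟨C, hC0, hC⟩ := exists_opNorm_proj_le x q (m := m) (by exact_mod_cast hm0)
  refine mem_rapidSubmodule_of_bound fun p => ?_
  obtain ⟨r, hr⟩ := exists_nat_gt (p / a)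
  rw [div_lt_iff₀ ha] at hr
  set A := wnorm r lam
  refine ⟨C * A ^ a, fun n => ?_⟩
  have hn : (1 : ℝ) ≤ (n : ℝ) + 1 := by linarith [Nat.cast_nonneg (α := ℝ) n]
  have hpos : 0 < ‖lam n‖ := norm_pos_iff.2 (h0 n)
  have h1 : ‖lam n‖ ^ θ * opNorm q (P n) ≤ C * ‖lam n‖ ^ a := by
    refine (mul_le_mul_of_nonneg_left (hC (P n) (lam n) (h0 n) (hidem n) (hself n) (hPx n))
      (by positivity)).trans (le_of_eq ?_)
    rw [mul_left_comm, ← Real.rpow_add hpos, ← sub_eq_add_neg]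
  have h2 : ‖lam n‖ ^ a * ((n : ℝ) + 1) ^ p ≤ A ^ a := by
    refine le_trans ?_ (Real.rpow_le_rpow (by positivity)
      (bound_of_mem_rapidSubmodule hlam r n) ha.le)
    rw [Real.mul_rpow hpos.le (by positivity), ← Real.rpow_natCast _ r, ← Real.rpow_natCast _ p,
      ← Real.rpow_mul (by positivity)]
    exact mul_le_mul_of_nonneg_left (Real.rpow_le_rpow_of_exponent_le hn hr.le) (by positivity)
  rw [Complex.norm_real, Real.norm_of_nonneg (mul_nonneg (by positivity) (opNorm_nonneg _ _))]
  calc _ ≤ C * ‖lam n‖ ^ a * ((n : ℝ) + 1) ^ p := by gcongr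
    _ = C * (‖lam n‖ ^ a * ((n : ℝ) + 1) ^ p) := mul_assoc _ _ _
    _ ≤ _ := mul_le_mul_of_nonneg_left h2 hC0

theorem summable_norm_of_mem_rapidSubmodule {ξ : ℕ → ℂ} (h : ξ ∈ rapidSubmodule) :
    Summable fun n => ‖ξ n‖ := by
  refine Summable.of_nonneg_of_le (fun _ => norm_nonneg _) (fun n => ?_)
    (summable_invSq.mul_left (wnorm (2 : ℕ) ξ))
  rw [← div_eq_mul_inv, le_div_iff₀ (by positivity)]
  exact bound_of_mem_rapidSubmodule h 2 n

/-- Convergence on `ℓ²` identifies the entries of each remainder as sums of tail entries; the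
summable norms of index `q + 2` bound these, hence the remainder in norm `q`. -/
theorem hasAbsSum_of_hasSum_toL2 {x : L} {y : ℕ → L}
    (hy : ∀ q, Summable fun n => opNorm q (y n)) (h : HasSum (fun n => toL2 (y n)) (toL2 x)) :
    HasAbsSum y x := by
  refine fun q => ⟨hy q, ?_⟩
  have hZ := invSqSum_nonneg
  have htail : Tendsto (fun N : ℕ => ∑' n, opNorm (q + 2) (y (n + N))) atTop (𝓝 0) :=
    tendsto_sum_nat_add fun n => opNorm (q + 2) (y n)
  refine squeeze_zero (fun _ => opNorm_nonneg _ _) (fun N => opNorm_le_of_entry_le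
    (B := ∑' n, opNorm (q + 2) (y (n + N))) fun i j => ?_)
    (by simpa using htail.const_mul (invSqSum * √invSqSum))
  have hs := (summable_nat_add_iff N).2 (hy (q + 2))
  have hent : HasSum (fun n => inner ℂ (basisVec i) (toL2 (y (n + N)) (basisVec j)))
      (inner ℂ (basisVec i) (toL2 (x - ∑ n ∈ Finset.range N, y n) (basisVec j))) := by
    have h1 : HasSum (fun n => toL2 (y (n + N))) (toL2 (x - ∑ n ∈ Finset.range N, y n)) := by
      rw [toL2_sub, toL2_sum]
      exact (hasSum_nat_add_iff' N).2 h
    exact (h1.mapL (ContinuousLinearMap.apply ℂ L2 (basisVec j))).mapL (innerSL ℂ (basisVec i))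
  simp only [inner_basisVec_left] at hent
  have hi : (0 : ℝ) < ((i : ℝ) + 1) ^ (q + 2) := by positivity
  have hj : (0 : ℝ) < ((j : ℝ) + 1) ^ (q + 2) := by positivity
  rw [← le_div_iff₀ hj, ← le_div_iff₀ hi, ← hent.tsum_eq]
  refine tsum_of_norm_bounded ((hs.hasSum.div_const _).div_const _) fun n => ?_
  rw [le_div_iff₀ hi, le_div_iff₀ hj]
  exact norm_entry_mul_le _ _ _ _

/-! ### Existence of a spectral representation -/

theorem exists_orthonormal_eigenvectors {H : Type*} [NormedAddCommGroup H] [InnerProductSpace ℂ H]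
    [CompleteSpace H] {T : H →L[ℂ] H} (hT : IsStarNormal T) {ι : Type*} {μ : ι → ℂ}
    (hμ : Function.Injective μ) (heig : ∀ i, HasEigenvalue (T : Module.End ℂ H) (μ i)) :
    ∃ f : ι → H, Orthonormal ℂ f ∧ ∀ i, T (f i) = μ i • f i := by
  have h1 : ∀ i, ∃ v : H, ‖v‖ = 1 ∧ T v = μ i • v := fun i => by
    obtain ⟨v, hv⟩ := (heig i).exists_hasEigenvector
    have hv1 : T v = μ i • v := hv.apply_eq_smul
    refine ⟨((‖v‖⁻¹ : ℝ) : ℂ) • v, ?_, by rw [map_smul, hv1, smul_comm]⟩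
    rw [norm_smul, Complex.norm_real, norm_inv, norm_norm,
      inv_mul_cancel₀ (norm_ne_zero_iff.2 hv.2)]
  choose f hf hTf using h1
  exact ⟨f, ⟨hf, fun i j hij => inner_eq_zero_of_apply_eq_smul hT (hμ.ne hij) (hTf i) (hTf j)⟩, hTf⟩

theorem exists_card_pow_mul_le_of_hasEigenvalue {x : L} (hx : IsNormal x) {k : ℕ} (hk : 0 < k) :
    ∃ C : ℝ, ∀ {ι : Type} [Fintype ι] (μ : ι → ℂ) (ε : ℝ), Function.Injective μ → 0 < ε →
      (∀ i, HasEigenvalue (toL2 x : Module.End ℂ L2) (μ i)) → (∀ i, ε ≤ ‖μ i‖) →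
      (Fintype.card ι : ℝ) ^ k * ε ≤ C := by
  obtain ⟨C, hC⟩ := exists_card_pow_mul_le x hk
  refine ⟨C, fun μ ε hinj hε heig hμ => ?_⟩
  obtain ⟨f, hf, hTf⟩ := exists_orthonormal_eigenvectors (isStarNormal_toL2 hx) hinj heig
  refine hC f (fun i => (starRingEnd ℂ) (μ i)) ε hf hε
    (fun i => adjoint_apply_of_apply_eq_smul (isStarNormal_toL2 hx) (hTf i)) fun i => ?_
  rw [RCLike.norm_conj]; exact hμ i

theorem finite_setOf_hasEigenvalue_le_norm {x : L} (hx : IsNormal x) {ε : ℝ} (hε : 0 < ε) :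
    {μ : ℂ | HasEigenvalue (toL2 x : Module.End ℂ L2) μ ∧ ε ≤ ‖μ‖}.Finite := by
  obtain ⟨C, hC⟩ := exists_card_pow_mul_le_of_hasEigenvalue hx one_pos
  by_contra hinf
  obtain ⟨N, hN⟩ := exists_nat_gt (C / ε)
  obtain ⟨t, ht, hcard⟩ := Set.Infinite.exists_subset_card_eq hinf N
  have h1 := hC (fun i : t => (i : ℂ)) ε Subtype.val_injective hε (fun i => (ht i.2).1)
    fun i => (ht i.2).2
  rw [Fintype.card_coe, hcard, pow_one] at h1
  rw [div_lt_iff₀ hε] at hN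
  linarith

theorem eigenvalues_mem_rapidSubmodule {x : L} (hx : IsNormal x) {lam : ℕ → ℂ}
    (hinj : Function.Injective lam) (h0 : ∀ n, lam n ≠ 0) (hanti : Antitone fun n => ‖lam n‖)
    (heig : ∀ n, HasEigenvalue (toL2 x : Module.End ℂ L2) (lam n)) : lam ∈ rapidSubmodule := by
  refine mem_rapidSubmodule_of_bound fun p => ?_
  obtain ⟨C, hC⟩ := exists_card_pow_mul_le_of_hasEigenvalue hx p.succ_pos
  refine ⟨C, fun n => ?_⟩
  -- The first `n + 1` eigenvalues all have modulus at least `‖lam n‖`.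
  have h1 := hC (fun i : Fin (n + 1) => lam i) ‖lam n‖ (hinj.comp Fin.val_injective)
    (norm_pos_iff.2 (h0 n)) (fun i => heig i) fun i => hanti (Nat.lt_succ_iff.1 i.2)
  rw [Fintype.card_fin, Nat.cast_succ, mul_comm] at h1
  refine le_trans (mul_le_mul_of_nonneg_left ?_ (norm_nonneg _)) h1
  refine pow_le_pow_right₀ ?_ p.le_succ
  linarith [Nat.cast_nonneg (α := ℝ) n]

theorem mul_starProjection_eigenspace {H : Type*} [NormedAddCommGroup H] [InnerProductSpace ℂ H]
    [CompleteSpace H] (T : H →L[ℂ] H) (μ : ℂ) :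
    T * (eigenspace (T : Module.End ℂ H) μ).starProjection =
      μ • (eigenspace (T : Module.End ℂ H) μ).starProjection := by
  ext v
  exact mem_eigenspace_iff.1 (Submodule.starProjection_apply_mem _ v)

theorem starProjection_eigenspace_mul {H : Type*} [NormedAddCommGroup H] [InnerProductSpace ℂ H]
    [CompleteSpace H] {T : H →L[ℂ] H} (hT : IsStarNormal T) (μ : ℂ) :
    (eigenspace (T : Module.End ℂ H) μ).starProjection * T =
      μ • (eigenspace (T : Module.End ℂ H) μ).starProjection := by
  set Q := (eigenspace (T : Module.End ℂ H) μ).starProjection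
  have hQ : adjoint Q = Q := (isSelfAdjoint_starProjection _).adjoint_eq
  ext v
  refine ext_inner_right ℂ fun w => ?_
  have h1 : T (Q w) = μ • Q w := mem_eigenspace_iff.1 (Submodule.starProjection_apply_mem _ w)
  rw [mul_apply_eq_comp, smul_apply, inner_smul_left,
    ← ContinuousLinearMap.adjoint_inner_right, hQ, ← ContinuousLinearMap.adjoint_inner_right,
    adjoint_apply_of_apply_eq_smul hT h1, inner_smul_right,
    ← ContinuousLinearMap.adjoint_inner_right Q v w, hQ]

/-- If `Q` is the eigenprojection, `x Q x = μ² Q`, and the left side maps `s'` into `s` because `x`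
stands at both ends. -/
theorem exists_toL2_eq_starProjection {x : L} (hx : IsNormal x) {μ : ℂ} (hμ : μ ≠ 0) :
    ∃ P : L, toL2 P = (eigenspace (toL2 x : Module.End ℂ L2) μ).starProjection := by
  set Q := (eigenspace (toL2 x : Module.End ℂ L2) μ).starProjection
  refine ⟨(μ⁻¹ * μ⁻¹) • x.comp (inclL2.comp (Q.comp (inclS.comp x))), ?_⟩
  have h1 : toL2 (x.comp (inclL2.comp (Q.comp (inclS.comp x)))) = toL2 x * Q * toL2 x := rfl
  rw [toL2_smul, h1, mul_starProjection_eigenspace, smul_mul_assoc,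
    starProjection_eigenspace_mul (isStarNormal_toL2 hx), smul_smul, smul_smul]
  convert one_smul ℂ Q using 2
  field_simp

theorem exists_isSpectralRepresentation {x : L} (hx : IsNormal x)
    (hinf : IsInfiniteDimensional x) :
    ∃ (lam : ℕ → ℂ) (P : ℕ → L), IsSpectralRepresentation x lam P := by
  have hT := isStarNormal_toL2 hx
  have hc := isCompactOperator_toL2 x
  obtain ⟨lam, hinj, hrange, hanti⟩ := exists_enumeration_antitone_norm
    (E := {μ : ℂ | μ ≠ 0 ∧ HasEigenvalue (toL2 x : Module.End ℂ L2) μ})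
    (fun h => hinf (finiteDimensional_range_of_finite_hasEigenvalue hc hT h))
    (fun ε hε => (finite_setOf_hasEigenvalue_le_norm hx hε).subset fun z hz => ⟨hz.1.2, hz.2⟩)
    (fun h => h.1 rfl)
  have hlam : ∀ n, lam n ≠ 0 ∧ HasEigenvalue (toL2 x : Module.End ℂ L2) (lam n) := fun n => by
    have h1 : lam n ∈ Set.range lam := ⟨n, rfl⟩
    rwa [hrange] at h1
  choose P hP using fun n => exists_toL2_eq_starProjection hx (hlam n).1
  have hmem := eigenvalues_mem_rapidSubmodule hx hinj (fun n => (hlam n).1) hanti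
    fun n => (hlam n).2
  have hidem : ∀ n, toL2 (P n) * toL2 (P n) = toL2 (P n) := fun n => by
    rw [hP]; exact Submodule.isIdempotentElem_starProjection _
  have hself : ∀ n, adjoint (toL2 (P n)) = toL2 (P n) := fun n => by
    rw [hP]; exact (isSelfAdjoint_starProjection _).adjoint_eq
  have hPx : ∀ n, toL2 (P n) * toL2 x = lam n • toL2 (P n) := fun n => by
    rw [hP]; exact starProjection_eigenspace_mul hT _
  have hfix : ∀ n v, toL2 x v = lam n • v → toL2 (P n) v = v := fun n v hv => by
    rw [hP, Submodule.starProjection_eq_self_iff]; exact mem_eigenspace_iff.2 hv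
  have hker : ∀ n (μ : ℂ) v, μ ≠ lam n → toL2 x v = μ • v → toL2 (P n) v = 0 := by
    intro n μ v hμ hv
    rw [hP, Submodule.starProjection_apply_eq_zero_iff, Submodule.mem_orthogonal]
    intro u hu
    exact inner_eq_zero_of_apply_eq_smul hT hμ.symm (mem_eigenspace_iff.1 hu) hv
  have hsummable : ∀ q, Summable fun n => opNorm q (lam n • P n) := fun q => by
    have h1 := summable_norm_of_mem_rapidSubmodule (rpow_mul_opNorm_mem_rapidSubmodule hmem
      (fun n => (hlam n).1) hidem hself hPx q one_pos)
    refine h1.congr fun n => ?_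
    rw [Complex.norm_real, Real.rpow_one, opNorm_smul,
      Real.norm_of_nonneg (mul_nonneg (norm_nonneg _) (opNorm_nonneg _ _))]
  have hsum : HasSum (fun n => toL2 (lam n • P n)) (toL2 x) := by
    have h1 : Summable fun n => toL2 (lam n • P n) :=
      Summable.of_norm_bounded (hsummable 0) fun n => norm_toL2_le _
    -- On an eigenvector at most one term of the series survives; if its eigenvalue is not listed,
    -- `x` sends the vector to zero.
    have h2 : ∑' n, toL2 (lam n • P n) = toL2 x := by
      refine eq_of_forall_eigenvector_apply_eq hc hT fun μ v hv => ?_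
      have h3 : HasSum (fun n => toL2 (lam n • P n) v) ((∑' n, toL2 (lam n • P n)) v) :=
        h1.hasSum.mapL (ContinuousLinearMap.apply ℂ L2 v)
      refine h3.unique ?_
      by_cases hμ : ∃ m, lam m = μ
      · obtain ⟨m, rfl⟩ := hμ
        have h4 : toL2 x v = toL2 (lam m • P m) v := by
          rw [toL2_smul, smul_apply, hfix m v hv, hv]
        rw [h4]
        refine hasSum_single m fun n hn => ?_
        rw [toL2_smul, smul_apply, hker n _ v (hinj.ne hn.symm) hv, smul_zero]
      · have h4 : toL2 x v = 0 := by
          by_contra hne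
          have h5 : μ ∈ Set.range lam := by
            rw [hrange]
            rw [hv, ← ne_eq, smul_ne_zero_iff] at hne
            exact ⟨hne.1, Module.End.hasEigenvalue_of_hasEigenvector
              ⟨mem_eigenspace_iff.2 hv, hne.2⟩⟩
          exact hμ h5
        rw [h4]
        convert hasSum_zero using 2 with n
        rw [toL2_smul, smul_apply, hker n μ v (fun h => hμ ⟨n, h.symm⟩) hv, smul_zero]
    rw [← h2]
    exact h1.hasSum
  refine ⟨lam, P, hmem, fun n => (hlam n).1, fun m n hmn => hinj.ne hmn, hanti,
    fun n => ⟨hidem n, hself n, ?_⟩, fun n h => ?_, fun m n hmn => ?_,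
    hasAbsSum_of_hasSum_toL2 hsummable hsum⟩
  · have := ContinuousLinearMap.finite_dimensional_eigenspace hc (lam n) (hlam n).1
    refine Submodule.finiteDimensional_of_le
      (S₂ := eigenspace (toL2 x : Module.End ℂ L2) (lam n)) ?_
    rintro _ ⟨v, rfl⟩
    rw [hP]
    exact Submodule.starProjection_apply_mem _ v
  · obtain ⟨v, hv⟩ := (hlam n).2.exists_hasEigenvector
    have h1 := hfix n v hv.apply_eq_smul
    rw [h, toL2_zero] at h1
    exact hv.2 h1.symm
  · ext1 v
    refine hker m (lam n) _ (hinj.ne hmn.symm) ?_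
    rw [hP]
    exact mem_eigenspace_iff.1 (Submodule.starProjection_apply_mem _ v)

end SmoothOp

namespace SmoothOp

open ContinuousLinearMap (adjoint)

/-! ### Uniqueness of the spectral representation -/

theorem eq_of_projections_of_forall_fixed {H : Type*} [NormedAddCommGroup H]
    [InnerProductSpace ℂ H] [CompleteSpace H] {P Q : H →L[ℂ] H} (hP : P * P = P)
    (hP' : adjoint P = P) (hQ : Q * Q = Q) (hQ' : adjoint Q = Q) (h : ∀ v, P v = v ↔ Q v = v) :
    P = Q := by
  have h1 : Q * P = P := by ext v; exact (h (P v)).1 (DFunLike.congr_fun hP v)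
  have h2 : P * Q = Q := by ext v; exact (h (Q v)).2 (DFunLike.congr_fun hQ v)
  calc P = star (Q * P) := by rw [h1, ContinuousLinearMap.star_eq_adjoint, hP']
    _ = P * Q := by
      rw [star_mul, ContinuousLinearMap.star_eq_adjoint, ContinuousLinearMap.star_eq_adjoint,
        hP', hQ']
    _ = Q := h2

theorem comp_perm_le_of_antitone {a : ℕ → ℝ} (σ : Equiv.Perm ℕ) (ha : Antitone a)
    (hσ : Antitone (a ∘ σ)) (n : ℕ) : a (σ n) ≤ a n := by
  -- Pigeonhole: `σ` cannot map the `n + 1` indices up to `n` into the `n` indices below `n`.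
  obtain ⟨i, hi, hin⟩ : ∃ i ≤ n, n ≤ σ i := by
    by_contra! hcon
    have h1 : (Finset.range (n + 1)).map σ.toEmbedding ⊆ Finset.range n := by
      intro k hk
      obtain ⟨i, hi, rfl⟩ := Finset.mem_map.1 hk
      exact Finset.mem_range.2 (hcon i (Nat.lt_succ_iff.1 (Finset.mem_range.1 hi)))
    have h2 := Finset.card_le_card h1
    simp at h2
  exact (hσ hi).trans (ha hin)

theorem comp_perm_eq_of_antitone {a : ℕ → ℝ} (σ : Equiv.Perm ℕ) (ha : Antitone a)
    (hσ : Antitone (a ∘ σ)) (n : ℕ) : a (σ n) = a n := by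
  refine (comp_perm_le_of_antitone σ ha hσ n).antisymm ?_
  have h1 : (a ∘ σ) ∘ σ.symm = a := by ext k; simp
  have h := comp_perm_le_of_antitone (a := a ∘ σ) σ.symm hσ (by rwa [h1]) n
  simpa using h

namespace IsSpectralRepresentation

variable {x : L} {lam : ℕ → ℂ} {P : ℕ → L}

theorem tendsto_toL2 (h : IsSpectralRepresentation x lam P) :
    Tendsto (fun N => ∑ n ∈ Finset.range N, lam n • toL2 (P n)) atTop (𝓝 (toL2 x)) := by
  rw [tendsto_iff_norm_sub_tendsto_zero]
  refine squeeze_zero (fun _ => norm_nonneg _) (fun N => ?_) (h.hasAbsSum 0).2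
  rw [norm_sub_rev]
  refine le_trans (le_of_eq ?_) (norm_toL2_le _)
  simp only [toL2_sub, toL2_sum, toL2_smul]

theorem toL2_mul_proj (h : IsSpectralRepresentation x lam P) (m : ℕ) :
    toL2 x * toL2 (P m) = lam m • toL2 (P m) := by
  refine tendsto_nhds_unique (h.tendsto_toL2.mul_const (toL2 (P m))) ?_
  refine tendsto_const_nhds.congr' ?_
  filter_upwards [eventually_gt_atTop m] with N hN
  rw [Finset.sum_mul, Finset.sum_eq_single m, smul_mul_assoc, (h.proj m).idem]
  · intro n _ hn
    rw [smul_mul_assoc, h.proj_orthogonal n m hn, smul_zero]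
  · intro hm; exact absurd (Finset.mem_range.2 hN) hm

theorem proj_mul_toL2 (h : IsSpectralRepresentation x lam P) (m : ℕ) :
    toL2 (P m) * toL2 x = lam m • toL2 (P m) := by
  refine tendsto_nhds_unique (h.tendsto_toL2.const_mul (toL2 (P m))) ?_
  refine tendsto_const_nhds.congr' ?_
  filter_upwards [eventually_gt_atTop m] with N hN
  rw [Finset.mul_sum, Finset.sum_eq_single m, mul_smul_comm, (h.proj m).idem]
  · intro n _ hn
    rw [mul_smul_comm, h.proj_orthogonal m n hn.symm, smul_zero]
  · intro hm; exact absurd (Finset.mem_range.2 hN) hm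

theorem proj_apply_eq_zero (h : IsSpectralRepresentation x lam P) {μ : ℂ} {v : L2}
    (hv : toL2 x v = μ • v) {n : ℕ} (hn : lam n ≠ μ) : toL2 (P n) v = 0 := by
  have h1 : toL2 (P n) (toL2 x v) = lam n • toL2 (P n) v :=
    DFunLike.congr_fun (h.proj_mul_toL2 n) v
  rw [hv, map_smul, eq_comm, ← sub_eq_zero, ← sub_smul] at h1
  exact (smul_eq_zero.1 h1).resolve_left (sub_ne_zero.2 hn)

theorem tendsto_toL2_apply (h : IsSpectralRepresentation x lam P) (v : L2) :
    Tendsto (fun N => ∑ n ∈ Finset.range N, lam n • toL2 (P n) v) atTop (𝓝 (toL2 x v)) := by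
  have h1 := ((ContinuousLinearMap.apply ℂ L2 v).continuous.tendsto _).comp h.tendsto_toL2
  refine h1.congr fun N => ?_
  simp

/-- This characterises the range of `P m` through `x` and `lam m` alone, which is the core of
uniqueness. On an eigenvector for `lam m` all other projections vanish, so the series for `x v`
collapses to one term. -/
theorem proj_apply_eq_self_iff (h : IsSpectralRepresentation x lam P) (m : ℕ) (v : L2) :
    toL2 (P m) v = v ↔ toL2 x v = lam m • v := by
  refine ⟨fun hv => ?_, fun hv => ?_⟩
  · have h1 : toL2 x (toL2 (P m) v) = lam m • toL2 (P m) v :=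
      DFunLike.congr_fun (h.toL2_mul_proj m) v
    rwa [hv] at h1
  · have h1 : lam m • toL2 (P m) v = toL2 x v := by
      refine tendsto_nhds_unique (tendsto_const_nhds.congr' ?_) (h.tendsto_toL2_apply v)
      filter_upwards [eventually_gt_atTop m] with N hN
      rw [Finset.sum_eq_single m]
      · intro n _ hn
        rw [h.proj_apply_eq_zero hv (fun he => h.lam_distinct n m hn he), smul_zero]
      · intro hm; exact absurd (Finset.mem_range.2 hN) hm
    rw [hv] at h1
    exact smul_right_injective _ (h.lam_ne_zero m) h1

theorem exists_lam_eq (h : IsSpectralRepresentation x lam P) {μ : ℂ} (hμ : μ ≠ 0) {v : L2}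
    (hv0 : v ≠ 0) (hv : toL2 x v = μ • v) : ∃ m, lam m = μ := by
  by_contra! hcon
  have h1 := h.tendsto_toL2_apply v
  simp only [h.proj_apply_eq_zero hv (hcon _), smul_zero, Finset.sum_const_zero] at h1
  have h2 := tendsto_nhds_unique h1 tendsto_const_nhds
  rw [hv] at h2
  exact (smul_ne_zero hμ hv0) h2

theorem exists_fixed_ne_zero (h : IsSpectralRepresentation x lam P) (m : ℕ) :
    ∃ v : L2, v ≠ 0 ∧ toL2 x v = lam m • v := by
  obtain ⟨w, hw⟩ : ∃ w, toL2 (P m) w ≠ 0 := by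
    by_contra! hcon
    exact h.proj_ne_zero m (eq_zero_of_toL2_eq_zero (ContinuousLinearMap.ext hcon))
  exact ⟨_, hw, (h.proj_apply_eq_self_iff m _).1 (DFunLike.congr_fun (h.proj m).idem w)⟩

theorem lam_injective (h : IsSpectralRepresentation x lam P) : Function.Injective lam :=
  fun m n hmn => by_contra fun hne => h.lam_distinct m n hne hmn

theorem exists_perm {lam' : ℕ → ℂ} {P' : ℕ → L} (h : IsSpectralRepresentation x lam P)
    (h' : IsSpectralRepresentation x lam' P') :
    ∃ σ : Equiv.Perm ℕ, ∀ n, lam' n = lam (σ n) ∧ P' n = P (σ n) ∧ ‖lam (σ n)‖ = ‖lam n‖ := by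
  have hex : ∀ {lam lam' : ℕ → ℂ} {P P' : ℕ → L}, IsSpectralRepresentation x lam P →
      IsSpectralRepresentation x lam' P' → ∀ n, ∃ m, lam m = lam' n := by
    intro lam lam' P P' h h' n
    obtain ⟨v, hv0, hv⟩ := h'.exists_fixed_ne_zero n
    exact h.exists_lam_eq (h'.lam_ne_zero n) hv0 hv
  choose f hf using hex h h'
  choose g hg using hex h' h
  -- Each coefficient of one representation is a nonzero eigenvalue and so occurs in the other;
  -- distinctness makes the two index maps mutually inverse.
  let σ : Equiv.Perm ℕ := ⟨f, g, fun n => h'.lam_injective (by rw [hg, hf]),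
    fun n => h.lam_injective (by rw [hf, hg])⟩
  have hσ : ∀ n, lam (σ n) = lam' n := hf
  refine ⟨σ, fun n => ⟨(hσ n).symm, toL2_injective ?_, ?_⟩⟩
  · refine eq_of_projections_of_forall_fixed (h'.proj n).idem (h'.proj n).selfAdjoint
      (h.proj _).idem (h.proj _).selfAdjoint fun v => ?_
    rw [h'.proj_apply_eq_self_iff, h.proj_apply_eq_self_iff, hσ]
  · refine comp_perm_eq_of_antitone (a := fun n => ‖lam n‖) σ
      (fun m n hmn => h.lam_decreasing m n hmn) (fun m n hmn => ?_) n
    simp only [Function.comp_apply, hσ]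
    exact h'.lam_decreasing m n hmn

end IsSpectralRepresentation

end SmoothOp

theorem mainTheorem1 (x : SmoothOp.L) (hnormal : SmoothOp.IsNormal x)
    (hinf : SmoothOp.IsInfiniteDimensional x) :
    (∃ (lam : ℕ → ℂ) (P : ℕ → SmoothOp.L), SmoothOp.IsSpectralRepresentation x lam P) ∧
    (∀ (lam lam' : ℕ → ℂ) (P P' : ℕ → SmoothOp.L),
      SmoothOp.IsSpectralRepresentation x lam P →
      SmoothOp.IsSpectralRepresentation x lam' P' →
      ∃ σ : Equiv.Perm ℕ, ∀ n,
        lam' n = lam (σ n) ∧ P' n = P (σ n) ∧ ‖lam (σ n)‖ = ‖lam n‖) ∧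
    (∀ (lam : ℕ → ℂ) (P : ℕ → SmoothOp.L),
      SmoothOp.IsSpectralRepresentation x lam P →
      ∀ (q : ℕ) (θ : ℝ), 0 < θ → θ ≤ 1 →
        (fun n => ((‖lam n‖ ^ θ * SmoothOp.opNorm q (P n) : ℝ) : ℂ)) ∈
          SmoothOp.rapidSubmodule) :=
  ⟨SmoothOp.exists_isSpectralRepresentation hnormal hinf,
    fun _ _ _ _ h h' => h.exists_perm h',
    fun _ _ h q _ hθ _ => SmoothOp.rpow_mul_opNorm_mem_rapidSubmodule h.lam_mem h.lam_ne_zero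
      (fun n => (h.proj n).idem) (fun n => (h.proj n).selfAdjoint) h.proj_mul_toL2 q hθ⟩
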